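/- **Setting.** Let $\Lambda\subset\mathbb R^2$ be the triangular lattice. A *triangulation* of a region $\Omega\subseteq\mathbb R^2$ (for example the closed region bounded by a simple closed polygon with vertices in $\Lambda$) is a set of nondegenerate triangles with vertices in $\Lambda$ that fill $\Omega$, any two of which meet in a common (possibly empty) face, and such that every point of $\Lambda\cap\Omega$ is a vertex; it is *equilateral* if all its edges have the same length. A *flip* on a convex quadrilateral that is the union of two adjacent triangles replaces the diagonal separating them by the other diagonal and so transforms a triangulation of $\Omega$ into another one. Flips are identified with their quadrilaterals. A *flip path* is a starting triangulation with a finite sequence of successively performable flips; it *generates* an edge if its last triangulation contains the edge. A *flip plan* that generates an edge from $T$ is a finite partially ordered set of flips whose linear orderings are exactly those flip paths from $T$ that generate the edge and consist of exactly the flips of the set, each performed once. It is a *minimum* flip plan if each of its linear orderings has the least length among all flip paths from $T$ that generate the edge. **Edges.** An edge $e=(x,y)$ at $v\in\Lambda$ is the segment from $v$ to $v+xu+yw$, where $x,y\ge 0$ are coprime integers and $(u,w)$ is one of the three anticlockwise pairs of consecutive lattice unit vectors (at angle $60^\circ$) in the directions $0^\circ,60^\circ,120^\circ,180^\circ$.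 Let $\phi(e)=x/y$ if $x<y$ and $\phi(e)=y/x$ otherwise; $\phi_e^{-1}$ sends a reduced fraction $a/b\in[0,1]$ to the edge $(a,b)$ if $x<y$ and to $(b,a)$ otherwise, with the same pair $(u,w)$. For $e\ne(1,0),(0,1)$ the *Farey neighbor edges* of $e$ are $(0,1),(1,0)$ if $e=(1,1)$, and otherwise the images under $\phi_e^{-1}$ of the two terms adjacent to $\phi(e)$ in the Farey sequence of order the denominator of $\phi(e)$. The *Farey parallelogram* $P_{e,v}$ has vertices $v,\,v+e_1,\,v+e,\,v+e_2$, with $e_1,e_2$ the Farey neighbor edges. **Algorithms.** The *Farey plan* $C$ of $e$ is empty if $e\in\{(1,0),(0,1)\}$. Otherwise start with $C$ empty, $X=(\tfrac01,\tfrac11)$, $d=\tfrac11$, and repeat until $C$ contains $\phi(e)$: append $d$ to $C$; replace $d$ by the mediant of $d$ and the term directly after $d$ in $X$ if $\phi(e)>d$, directly before $d$ otherwise; insert the new $d$ in $X$. The *Flip plan* $\pi_{e,v}$, for $C=(f_1,\dots,f_n)$, is empty if $n=0$, and is the single flip on $P_{(1,1),v}$ if $n=1$. If $n\ge 2$, let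 $e_1=\phi_e^{-1}(f_{n-1})$ and let $e_2$ be the shorter boundary edge of $P_{e,v}$; then $\pi_{e,v}$ has the root flip on $P_{e,v}$, whose children are the root flips of $\pi_{e_1,v}$ and $\pi_{e_1,v+e_2}$, obtained recursively from the Farey plan $(f_1,\dots,f_{n-1})$. Equal flips are identified, and the partial order is the one in which descendants are smaller. **Theorem (Unique Minimum Flip Plan for an Edge).** Let $T$ be an equilateral triangulation of $\Omega$, and let $e$ be an edge at $v\in\Lambda$ whose segment is contained in $\Omega$. Then there is a unique minimum flip plan that generates $e$ at $v$ from $T$. It is the partially ordered set $\pi_{e,v}$; thus every minimum flip plan for $e$ at $v$ contains exactly the flips of $\pi_{e,v}$. All flips of $\pi_{e,v}$ are performed on Farey parallelograms of edges other than $(1,0)$ and $(0,1)$. -/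

import Mathlib

namespace LatticeFlip

/-! ### The triangular lattice

The lattice point `(a, b)` stands for `a • u + b • w`, where `u` and `w` are unit vectors of the
Euclidean plane at an angle of sixty degrees, and the plane itself is described by its real
coordinates with respect to `u` and `w`. -/

/-- Points of the triangular lattice. -/
abbrev Pt := ℤ × ℤ

/-- The plane. -/
abbrev Plane := ℝ × ℝ

/-- A lattice point as a point of the plane. -/
def toPlane (p : Pt) : Plane := ((p.1 : ℝ), (p.2 : ℝ))

/-- The squared Euclidean length of a lattice vector. -/
def lenSq (p : Pt) : ℤ := p.1 ^ 2 + p.1 * p.2 + p.2 ^ 2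

/-- The convex polygon spanned by a finite set of lattice points. -/
def hull (s : Finset Pt) : Set Plane := convexHull ℝ (toPlane '' (s : Set Pt))

/-! ### Lattice triangulations -/

/-- A lattice triangulation of a region `Ω` of the plane, given by its triangular facets: they are
nondegenerate lattice triangles, any two of them meet in a common face (possibly empty), they fill
`Ω`, and every lattice point of `Ω` is a vertex. -/
@[ext]
structure Triangulation (Ω : Set Plane) where
  triangles : Set (Finset Pt)
  card_eq_three : ∀ t ∈ triangles, t.card = 3
  affineIndependent : ∀ t ∈ triangles, AffineIndependent ℝ (fun p : t => toPlane p)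
  inter_eq : ∀ s ∈ triangles, ∀ t ∈ triangles, hull s ∩ hull t = hull (s ∩ t)
  cover : ⋃ t ∈ triangles, hull t = Ω
  full : ∀ p : Pt, toPlane p ∈ Ω → ∃ t ∈ triangles, p ∈ t

/-- The segment joining `a` and `b` is an edge of the triangulation. -/
def Triangulation.HasEdge {Ω : Set Plane} (T : Triangulation Ω) (a b : Pt) : Prop :=
  a ≠ b ∧ ∃ t ∈ T.triangles, a ∈ t ∧ b ∈ t

/-- All edges of the triangulation have the same length. -/
def Triangulation.IsEquilateral {Ω : Set Plane} (T : Triangulation Ω) : Prop :=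
  ∀ a b c d : Pt, T.HasEdge a b → T.HasEdge c d → lenSq (b - a) = lenSq (d - c)

/-! ### Flips and flip paths -/

/-- A flip is recorded by the vertex set of the quadrilateral on which it is performed. -/
abbrev Quad := Finset Pt

/-- `T'` arises from `T` by a diagonal flip on the quadrilateral `Q`: here `Q` has the vertices
`a, b, c, d` in cyclic order, it is convex (its two diagonals cross), it is the union of the facets
`abc` and `acd` of `T`, and its diagonal `ac` is replaced by the diagonal `bd`. -/
def IsFlip {Ω : Set Plane} (T : Triangulation Ω) (Q : Quad) (T' : Triangulation Ω) : Prop :=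
  ∃ a b c d : Pt,
    Q = {a, b, c, d} ∧
    (openSegment ℝ (toPlane a) (toPlane c) ∩ openSegment ℝ (toPlane b) (toPlane d)).Nonempty ∧
    {a, b, c} ∈ T.triangles ∧ {a, c, d} ∈ T.triangles ∧
    T'.triangles = (T.triangles \ {{a, b, c}, {a, c, d}}) ∪ {{a, b, d}, {b, c, d}}

/-- `IsFlipPath T L T'`: performing the flips in the list `L` one after the other, beginning with
the first, is possible and leads from `T` to `T'`. -/
inductive IsFlipPath {Ω : Set Plane} : Triangulation Ω → List Quad → Triangulation Ω → Prop
  | nil (T : Triangulation Ω) : IsFlipPath T [] T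
  | cons {T T' T'' : Triangulation Ω} {Q : Quad} {L : List Quad} :
      IsFlip T Q T' → IsFlipPath T' L T'' → IsFlipPath T (Q :: L) T''

/-- The flips in `L`, performed in this order, form a flip path from `T` that generates the edge
joining `a` and `b`, which means that the target triangulation contains it. -/
def Generates {Ω : Set Plane} (T : Triangulation Ω) (L : List Quad) (a b : Pt) : Prop :=
  ∃ T' : Triangulation Ω, IsFlipPath T L T' ∧ T'.HasEdge a b

/-! ### Flip plans -/

/-- A finite set of flips with a relation between flips. -/
@[ext]
structure FlipPoset where
  flips : Finset Quad
  le : Quad → Quad → Prop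

/-- The relation is a partial order on the set of flips (and relates nothing else). -/
structure FlipPoset.IsPoset (π : FlipPoset) : Prop where
  mem_of_le : ∀ P Q, π.le P Q → P ∈ π.flips ∧ Q ∈ π.flips
  refl : ∀ P ∈ π.flips, π.le P P
  trans : ∀ P Q R, π.le P Q → π.le Q R → π.le P R
  antisymm : ∀ P Q, π.le P Q → π.le Q P → P = Q

/-- The list consists of exactly the flips in `π`, each of them once. -/
def FlipPoset.ListsFlips (π : FlipPoset) (L : List Quad) : Prop :=
  L.Nodup ∧ ∀ Q, Q ∈ L ↔ Q ∈ π.flips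

/-- A valid linear ordering of `π`: smaller flips come first. -/
def FlipPoset.IsLinearOrdering (π : FlipPoset) (L : List Quad) : Prop :=
  π.ListsFlips L ∧ L.Pairwise (fun P Q => ¬ π.le Q P)

/-- `π` is a flip plan that generates the edge joining `a` and `b` from `T`: it is a partially
ordered set of flips whose valid linear orderings are exactly the flip paths that generate the edge
from `T` and contain exactly the flips in `π`. -/
def FlipPoset.IsFlipPlan {Ω : Set Plane} (π : FlipPoset) (T : Triangulation Ω) (a b : Pt) : Prop :=
  π.IsPoset ∧ ∀ L : List Quad, π.IsLinearOrdering L ↔ (Generates T L a b ∧ π.ListsFlips L)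

/-- A minimum flip plan: each of its valid linear orderings is a shortest flip path among all
flip paths that generate the edge from `T`. -/
def FlipPoset.IsMinimumFlipPlan {Ω : Set Plane} (π : FlipPoset) (T : Triangulation Ω)
    (a b : Pt) : Prop :=
  π.IsFlipPlan T a b ∧
    ∀ L : List Quad, π.IsLinearOrdering L → ∀ L' : List Quad, Generates T L' a b →
      L.length ≤ L'.length

/-! ### Edges -/

/-- The three defining coordinate pairs of unit vectors, each in anticlockwise order. -/
def coordPair : Fin 3 → Pt × Pt
  | 0 => ((1, 0), (0, 1))
  | 1 => ((0, 1), (-1, 1))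
  | 2 => ((-1, 1), (-1, 0))

/-- An edge (up to lattice shifts): nonnegative coprime coefficients with respect to a defining
coordinate pair. -/
structure Edge where
  pair : Fin 3
  x : ℕ
  y : ℕ
  coprime : x.Coprime y

/-- The edge as a lattice vector. -/
def Edge.vec (e : Edge) : Pt :=
  (e.x : ℤ) • (coordPair e.pair).1 + (e.y : ℤ) • (coordPair e.pair).2

/-! ### Farey sequences and Farey parallelograms -/

/-- The set of terms of the Farey sequence of order `n`; the sequence lists them in increasing
order. -/
def fareySeq (n : ℕ) : Finset ℚ :=
  ((Finset.range (n + 1) ×ˢ Finset.Icc 1 n).image (fun p => (p.1 : ℚ) / (p.2 : ℚ))).filter (· ≤ 1)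

/-- The term directly before `d` in the increasing sequence with terms `X`. -/
def termBefore (X : Finset ℚ) (d : ℚ) : ℚ := (X.filter (· < d)).max.unbotD 0

/-- The term directly after `d` in the increasing sequence with terms `X`. -/
def termAfter (X : Finset ℚ) (d : ℚ) : ℚ := (X.filter (d < ·)).min.untopD 1

/-- The mediant of two reduced fractions. -/
def mediant (p q : ℚ) : ℚ := ((p.num + q.num : ℤ) : ℚ) / ((p.den + q.den : ℕ) : ℚ)

/-- The Farey-flip map. -/
def Edge.toFarey (e : Edge) : ℚ := if e.x < e.y then (e.x : ℚ) / e.y else (e.y : ℚ) / e.x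

/-- The inverse of the Farey-flip map that belongs to the edge `e`. -/
def Edge.ofFarey (e : Edge) (q : ℚ) : Edge :=
  if e.x < e.y then ⟨e.pair, q.num.natAbs, q.den, q.reduced⟩
  else ⟨e.pair, q.den, q.num.natAbs, q.reduced.symm⟩

/-- The Farey neighbor edges of `e` in the Farey sequence where `e` first appears, whose order is
the denominator of the fraction of `e`. The edge `(1, 1)`, whose fraction is the last term, has the
neighbors `(0, 1)` and `(1, 0)`. Only meaningful if `e` is not of unit length. -/
def Edge.neighbors (e : Edge) : Edge × Edge :=
  if e.x = 1 ∧ e.y = 1 then (⟨e.pair, 0, 1, by simp⟩, ⟨e.pair, 1, 0, by simp⟩)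
  else (e.ofFarey (termBefore (fareySeq e.toFarey.den) e.toFarey),
    e.ofFarey (termAfter (fareySeq e.toFarey.den) e.toFarey))

/-- The edge is `(1, 0)` or `(0, 1)`. -/
def Edge.IsUnit (e : Edge) : Prop := (e.x = 1 ∧ e.y = 0) ∨ (e.x = 0 ∧ e.y = 1)

instance (e : Edge) : Decidable e.IsUnit := by unfold Edge.IsUnit; infer_instance

/-- The shorter boundary edge of the Farey parallelogram for `e`. -/
def Edge.shorterNeighbor (e : Edge) : Edge :=
  if lenSq e.neighbors.1.vec ≤ lenSq e.neighbors.2.vec then e.neighbors.1 else e.neighbors.2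

/-- The Farey parallelogram for `e` at `v`: `e` is a diagonal, and the boundary edges are copies of
the Farey neighbor edges of `e`. -/
def fareyParallelogram (e : Edge) (v : Pt) : Quad :=
  {v, v + e.neighbors.1.vec, v + e.vec, v + e.neighbors.2.vec}

/-! ### The Farey plan of an edge -/

/-- The state of the Farey plan algorithm: the plan `C`, the sequence `X`, the fraction `d`. -/
structure FareyState where
  C : List ℚ
  X : Finset ℚ
  d : ℚ

/-- One round of the algorithm for the fraction `f`; nothing happens once `C` contains `f`. -/
def fareyStep (f : ℚ) (s : FareyState) : FareyState :=
  if f ∈ s.C then s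
  else
    let d' := if f > s.d then mediant s.d (termAfter s.X s.d) else mediant s.d (termBefore s.X s.d)
    ⟨s.C ++ [s.d], insert d' s.X, d'⟩

/-- The Farey plan of an edge. The plan has at most as many terms as the denominator of the
fraction of `e` says, so the loop has ended after that many rounds. -/
def fareyPlan (e : Edge) : List ℚ :=
  if e.IsUnit then []
  else ((fareyStep e.toFarey)^[e.toFarey.den] ⟨[], fareySeq 1, 1⟩).C

/-! ### The flip plan of an edge -/

/-- A directed acyclic graph of flips; an arc is a pair (child, parent). Equal flips are
identified, because the flips form a set. -/
structure FlipDag where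
  flips : Finset Quad
  arcs : Finset (Quad × Quad)

/-- The recursion of the flip plan algorithm. The Farey plan is given with its last term first. -/
def flipDag : List ℚ → Edge → Pt → FlipDag
  | [], _, _ => ⟨∅, ∅⟩
  | [_], e, v => ⟨{fareyParallelogram e v}, ∅⟩
  | _ :: g :: C, e, v =>
    let s := fareyParallelogram e v
    let e₁ := e.ofFarey g
    let w := v + e.shorterNeighbor.vec
    let D₁ := flipDag (g :: C) e₁ v
    let D₂ := flipDag (g :: C) e₁ w
    ⟨{s} ∪ D₁.flips ∪ D₂.flips,
      {(fareyParallelogram e₁ v, s), (fareyParallelogram e₁ w, s)} ∪ D₁.arcs ∪ D₂.arcs⟩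

/-- The partially ordered set of flips that the flip plan algorithm outputs for the edge `e` at
`v`: a flip is below another one if it is a descendant of it. -/
def flipPlan (e : Edge) (v : Pt) : FlipPoset :=
  let D := flipDag (fareyPlan e).reverse e v
  ⟨D.flips, fun P Q => P ∈ D.flips ∧ Q ∈ D.flips ∧
    Relation.ReflTransGen (fun A B => (A, B) ∈ D.arcs) P Q⟩

end LatticeFlip

open LatticeFlip

/-!
The Farey neighbors of an edge are found by bisecting Farey intervals, so the parallelograms of the
flip plan are spanned by bases in the binary tree in which a basis `(p, q)` of the lattice is
followed by `(p, p + q)` and `(p + q, q)`, starting from the two unit vectors of the edge. The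
children of a flip belong to the preceding basis, whose sum is a side of the parallelogram.

Give a lattice vector as level the sum of its coordinates with respect to the two unit vectors. All
edges of an equilateral triangulation have level at most one, whereas the diagonals that the flips
of the plan produce have level at least two, so they have to be generated by flips. A flip keeps
all triangles at their least possible area, hence it takes place on a parallelogram spanned by a
basis whose sum is the generated diagonal. If this is not the Farey parallelogram of the diagonal,
one of its sides is a diagonal later in the tree, whose own plan contains the present one. If it
is, then the diagonals of the two children of the flip are sides of it and must be present before.
By induction, every flip path that generates the edge contains all flips of the plan, and children
come before their parents.

Conversely, the segment of the edge crosses the interior of every unit parallelogram of the plan,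
so the two halves of these are triangles of the given triangulation. Every other triangle that a
flip of the plan removes is added by one of the children of this flip, and no triangle is added
again after its removal. Hence every linear ordering of the plan can be performed. A plan all of
whose flips are necessary is a minimum one, any other minimum one has the same linear orderings,
and a finite poset is determined by its linear orderings.
-/

namespace LatticeFlip

/-! ### The binary tree of bases -/

section Tree

variable {M N : Type*}

/-- The node reached from `(U, W)` in the binary tree of bases, in which `(p, q)` has the children
`(p, p + q)` and `(p + q, q)`. The head of the list is the last step, and `true` keeps `p`. -/
def treeBasis [Add M] (U W : M) : List Bool → M × M
  | [] => (U, W)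
  | true :: l => ((treeBasis U W l).1, (treeBasis U W l).1 + (treeBasis U W l).2)
  | false :: l => ((treeBasis U W l).1 + (treeBasis U W l).2, (treeBasis U W l).2)

/-- The sum of the two vectors of a basis of the tree, that is, the vector that both children of
the basis share. -/
def treeVec [Add M] (U W : M) (l : List Bool) : M := (treeBasis U W l).1 + (treeBasis U W l).2

/-- The vector of a basis of the tree that is kept by the step `b`. -/
def treeShift [Add M] (U W : M) (b : Bool) (l : List Bool) : M :=
  if b then (treeBasis U W l).1 else (treeBasis U W l).2

theorem treeVec_cons [AddCommMagma M] (U W : M) (b : Bool) (l : List Bool) :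
    treeVec U W (b :: l) = treeVec U W l + treeShift U W b l := by
  cases b
  · rfl
  · exact add_comm _ _

theorem treeBasis_append [Add M] (U W : M) (l m : List Bool) :
    treeBasis U W (l ++ m) = treeBasis (treeBasis U W m).1 (treeBasis U W m).2 l := by
  induction l with
  | nil => rfl
  | cons b l ih => cases b <;> simp only [List.cons_append, treeBasis, ih]

theorem treeVec_append [Add M] (U W : M) (l m : List Bool) :
    treeVec U W (l ++ m) = treeVec (treeBasis U W m).1 (treeBasis U W m).2 l := by
  rw [treeVec, treeBasis_append, treeVec]

theorem treeBasis_map [AddMonoid M] [AddMonoid N] (f : M →+ N) (U W : M) (l : List Bool) :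
    treeBasis (f U) (f W) l = (treeBasis U W l).map f f := by
  induction l with
  | nil => rfl
  | cons b l ih => cases b <;> simp [treeBasis, ih]

theorem treeBasis_map_not [AddCommMagma M] (U W : M) (l : List Bool) :
    treeBasis U W (l.map not) = (treeBasis W U l).swap := by
  induction l with
  | nil => rfl
  | cons b l ih => cases b <;> simp [treeBasis, ih, add_comm]

/-- The tree runs Euclid's algorithm. -/
theorem exists_treeVec_eq [AddCommMonoid M] {x y : ℕ} (h : x.Coprime y) (hx : 0 < x)
    (hy : 0 < y) : ∃ l, ∀ U W : M, treeVec U W l = x • U + y • W := by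
  rcases lt_trichotomy x y with hlt | rfl | hlt
  · obtain ⟨z, rfl⟩ := Nat.exists_eq_add_of_le hlt.le
    obtain ⟨l, hl⟩ := exists_treeVec_eq (y := z) (by simpa using h) hx (by omega)
    exact ⟨l ++ [false], fun U W => by
      simp only [treeVec_append, treeBasis, hl, add_smul, smul_add, add_assoc]⟩
  · obtain rfl : x = 1 := by simpa using h
    exact ⟨[], fun U W => by simp [treeVec, treeBasis]⟩
  · obtain ⟨z, rfl⟩ := Nat.exists_eq_add_of_le hlt.le
    obtain ⟨l, hl⟩ := exists_treeVec_eq (x := z) (by simpa using h) (by omega) hy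
    refine ⟨l ++ [true], fun U W => ?_⟩
    simp only [treeVec_append, treeBasis, hl, add_smul, smul_add]
    abel
termination_by x + y

end Tree

/-! ### Farey intervals -/

/-- A pair (numerator, denominator) as a fraction. -/
def frac (p : ℕ × ℕ) : ℚ := p.1 / p.2

theorem frac_lt_frac {p q : ℕ × ℕ} (hp : 0 < p.2) (hq : 0 < q.2) :
    frac p < frac q ↔ p.1 * q.2 < q.1 * p.2 := by
  rw [frac, frac, div_lt_div_iff₀ (by positivity) (by positivity)]
  exact_mod_cast Iff.rfl

theorem num_frac {p : ℕ × ℕ} (h : p.1.Coprime p.2) (hp : 0 < p.2) : (frac p).num = p.1 := by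
  have := Rat.num_div_eq_of_coprime (a := p.1) (b := p.2) (by omega) (by simpa using h)
  simpa [frac] using this

theorem den_frac {p : ℕ × ℕ} (h : p.1.Coprime p.2) (hp : 0 < p.2) : (frac p).den = p.2 := by
  have := Rat.den_div_eq_of_coprime (a := p.1) (b := p.2) (by omega) (by simpa using h)
  rwa [Int.cast_natCast, Int.cast_natCast, Nat.cast_inj] at this

/-- The fractions `p` and `q`, given as pairs (numerator, denominator), bound a Farey interval
inside the unit interval: `p < q` and their determinant is one. -/
structure IsFareyPair (p q : ℕ × ℕ) : Prop where
  det : q.1 * p.2 = p.1 * q.2 + 1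
  lt : p.1 < p.2
  le : q.1 ≤ q.2

namespace IsFareyPair

variable {p q : ℕ × ℕ} (h : IsFareyPair p q)
include h

theorem left : IsFareyPair p (p + q) where
  det := by simp only [Prod.fst_add, Prod.snd_add]; linarith [h.det]
  lt := h.lt
  le := by simp only [Prod.fst_add, Prod.snd_add]; linarith [h.lt, h.le]

theorem right : IsFareyPair (p + q) q where
  det := by simp only [Prod.fst_add, Prod.snd_add]; linarith [h.det]
  lt := by simp only [Prod.fst_add, Prod.snd_add]; linarith [h.lt, h.le]
  le := h.le

theorem den_left_pos : 0 < p.2 := h.lt.trans_le' (Nat.zero_le _)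

theorem den_right_pos : 0 < q.2 := by
  have : q.1 ≠ 0 := fun h0 => by simpa [h0] using h.det
  exact (Nat.pos_of_ne_zero this).trans_le h.le

theorem coprime_left : p.1.Coprime p.2 := by
  have hdvd : p.1.gcd p.2 ∣ p.1 * q.2 + 1 := h.det ▸ (p.1.gcd_dvd_right p.2).mul_left q.1
  exact Nat.dvd_one.1 ((Nat.dvd_add_right ((p.1.gcd_dvd_left p.2).mul_right q.2)).1 hdvd)

theorem coprime_right : q.1.Coprime q.2 := by
  have hdvd : q.1.gcd q.2 ∣ p.1 * q.2 + 1 := h.det ▸ (q.1.gcd_dvd_left q.2).mul_right p.2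
  exact Nat.dvd_one.1 ((Nat.dvd_add_right ((q.1.gcd_dvd_right q.2).mul_left p.1)).1 hdvd)

theorem frac_lt : frac p < frac q := by
  rw [frac_lt_frac h.den_left_pos h.den_right_pos, h.det]
  exact Nat.lt_succ_self _

theorem mediant_eq : mediant (frac p) (frac q) = frac (p + q) := by
  rw [mediant, num_frac h.coprime_left h.den_left_pos, num_frac h.coprime_right h.den_right_pos,
    den_frac h.coprime_left h.den_left_pos, den_frac h.coprime_right h.den_right_pos]
  simp [frac]

end IsFareyPair

theorem mediant_comm (a b : ℚ) : mediant a b = mediant b a := by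
  rw [mediant, mediant, add_comm a.num, add_comm a.den]

theorem termBefore_eq {X : Finset ℚ} {d x : ℚ} (hx : x ∈ X) (h : x < d)
    (hX : ∀ y ∈ X, y < d → y ≤ x) : termBefore X d = x := by
  suffices (X.filter (· < d)).max = x by rw [termBefore, this]; rfl
  refine (Finset.le_max (Finset.mem_filter.2 ⟨hx, h⟩)).antisymm' (Finset.max_le fun y hy => ?_)
  rw [Finset.mem_filter] at hy
  exact WithBot.coe_le_coe.2 (hX y hy.1 hy.2)

theorem termAfter_eq {X : Finset ℚ} {d x : ℚ} (hx : x ∈ X) (h : d < x)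
    (hX : ∀ y ∈ X, d < y → x ≤ y) : termAfter X d = x := by
  suffices (X.filter (d < ·)).min = x by rw [termAfter, this]; rfl
  refine (Finset.min_le (Finset.mem_filter.2 ⟨hx, h⟩)).antisymm (Finset.le_min fun y hy => ?_)
  rw [Finset.mem_filter] at hy
  exact WithTop.coe_le_coe.2 (hX y hy.1 hy.2)

theorem mem_fareySeq {n : ℕ} {x : ℚ} :
    x ∈ fareySeq n ↔ ∃ p : ℕ × ℕ, 0 < p.2 ∧ p.2 ≤ n ∧ p.1 ≤ p.2 ∧ x = frac p := by
  have frac_le_one {p : ℕ × ℕ} (hp : 0 < p.2) : frac p ≤ 1 ↔ p.1 ≤ p.2 := by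
    rw [frac, div_le_one (by positivity), Nat.cast_le]
  simp only [fareySeq, Finset.mem_filter, Finset.mem_image, Finset.mem_product, Finset.mem_range,
    Finset.mem_Icc]
  constructor
  · rintro ⟨⟨p, ⟨-, h0, hn⟩, rfl⟩, h1⟩
    exact ⟨p, h0, hn, (frac_le_one h0).1 h1, rfl⟩
  · rintro ⟨p, h0, hn, h1, rfl⟩
    exact ⟨⟨p, ⟨by omega, h0, hn⟩, rfl⟩, (frac_le_one h0).2 h1⟩

theorem fareySeq_one : fareySeq 1 = {0, 1} := by
  ext x
  simp only [mem_fareySeq, Finset.mem_insert, Finset.mem_singleton]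
  constructor
  · rintro ⟨⟨a, b⟩, h0, h1, hab, rfl⟩
    obtain rfl : b = 1 := by omega
    obtain rfl | rfl : a = 0 ∨ a = 1 := by omega
    · simp [frac]
    · simp [frac]
  · rintro (rfl | rfl)
    · exact ⟨(0, 1), by simp [frac]⟩
    · exact ⟨(1, 1), by simp [frac]⟩

namespace IsFareyPair

variable {p q : ℕ × ℕ} (h : IsFareyPair p q)
include h

theorem le_or_le_of_mem_fareySeq {n : ℕ} (hn : n < p.2 + q.2) {x : ℚ} (hx : x ∈ fareySeq n) :
    x ≤ frac p ∨ frac q ≤ x := by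
  obtain ⟨r, hr, hrn, -, rfl⟩ := mem_fareySeq.1 hx
  by_contra! hlt
  rw [frac_lt_frac h.den_left_pos hr, frac_lt_frac hr h.den_right_pos] at hlt
  have hdet := h.det
  zify at hlt hdet hn hrn
  have key : (r.2 : ℤ) = p.2 * (q.1 * r.2 - r.1 * q.2) + q.2 * (r.1 * p.2 - p.1 * r.2) := by
    linear_combination (-r.2 : ℤ) * hdet
  nlinarith [h.den_left_pos, h.den_right_pos]

theorem termBefore_fareySeq : termBefore (fareySeq (p + q).2) (frac (p + q)) = frac p := by
  refine termBefore_eq (mem_fareySeq.2 ⟨p, h.den_left_pos, by simp, h.lt.le, rfl⟩) h.left.frac_lt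
    fun y hy hlt => (h.left.le_or_le_of_mem_fareySeq ?_ hy).resolve_right hlt.not_ge
  exact Nat.lt_add_of_pos_left h.den_left_pos

theorem termAfter_fareySeq : termAfter (fareySeq (p + q).2) (frac (p + q)) = frac q := by
  refine termAfter_eq (mem_fareySeq.2 ⟨q, h.den_right_pos, by simp, h.le, rfl⟩) h.right.frac_lt
    fun y hy hlt => (h.right.le_or_le_of_mem_fareySeq ?_ hy).resolve_left hlt.not_ge
  exact Nat.lt_add_of_pos_right h.den_right_pos

end IsFareyPair

/-- The Farey interval reached by bisecting the interval from `0 / 1` to `1 / 1`, where `true`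
stands for the left part. -/
abbrev fareyInterval (l : List Bool) : (ℕ × ℕ) × (ℕ × ℕ) := treeBasis (0, 1) (1, 1) l

/-- The mediant of the ends of a Farey interval, as a pair (numerator, denominator). -/
abbrev fareyMid (l : List Bool) : ℕ × ℕ := treeVec (0, 1) (1, 1) l

theorem isFareyPair_fareyInterval (l : List Bool) :
    IsFareyPair (fareyInterval l).1 (fareyInterval l).2 := by
  induction l with
  | nil => exact ⟨rfl, Nat.one_pos, le_rfl⟩
  | cons b l ih =>
    cases b
    · exact ih.right
    · exact ih.left

theorem fareyInterval_fst_lt_fareyMid (l : List Bool) :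
    frac (fareyInterval l).1 < frac (fareyMid l) :=
  (isFareyPair_fareyInterval l).left.frac_lt

theorem fareyMid_lt_fareyInterval_snd (l : List Bool) :
    frac (fareyMid l) < frac (fareyInterval l).2 :=
  (isFareyPair_fareyInterval l).right.frac_lt

theorem coprime_fareyMid (l : List Bool) : (fareyMid l).1.Coprime (fareyMid l).2 :=
  (isFareyPair_fareyInterval l).left.coprime_right

theorem length_add_two_le_den_fareyMid (l : List Bool) : l.length + 2 ≤ (fareyMid l).2 := by
  induction l with
  | nil => exact le_rfl
  | cons b l ih =>
    have h := isFareyPair_fareyInterval l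
    have hpos : 0 < (treeShift (0, 1) (1, 1) b l : ℕ × ℕ).2 := by
      cases b
      · exact h.den_right_pos
      · exact h.den_left_pos
    rw [fareyMid] at ih ⊢
    rw [treeVec_cons, Prod.snd_add, List.length_cons]
    omega

theorem den_fareyMid_pos (l : List Bool) : 0 < (fareyMid l).2 :=
  (length_add_two_le_den_fareyMid l).trans_lt' (by omega)

theorem frac_fareyMid_pos (l : List Bool) : 0 < frac (fareyMid l) :=
  (fareyInterval_fst_lt_fareyMid l).trans_le' (by rw [frac]; positivity)

theorem frac_fareyMid_lt_one (l : List Bool) : frac (fareyMid l) < 1 := by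
  rw [frac, div_lt_one (by exact_mod_cast den_fareyMid_pos l), Nat.cast_lt]
  exact (isFareyPair_fareyInterval l).right.lt

theorem frac_natAbs_num_den {q : ℚ} (h : 0 ≤ q) : frac (q.num.natAbs, q.den) = q := by
  rw [frac, Nat.cast_natAbs, abs_of_nonneg (Rat.num_nonneg.2 h), Rat.num_div_den]

theorem exists_frac_fareyMid_eq {q : ℚ} (h0 : 0 < q) (h1 : q < 1) :
    ∃ l, frac (fareyMid l) = q := by
  have hnum := Rat.num_pos.2 h0
  have hlt := Rat.num_lt_denom_iff.2 h1
  obtain ⟨z, hz⟩ : ∃ z, q.den = z + q.num.natAbs := ⟨q.den - q.num.natAbs, by omega⟩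
  obtain ⟨l, hl⟩ := exists_treeVec_eq (M := ℕ × ℕ) (x := z) (y := q.num.natAbs)
    (by simpa [hz, Nat.coprime_comm] using q.reduced) (by omega) (by omega)
  refine ⟨l, Eq.trans (congrArg frac ?_) (frac_natAbs_num_den h0.le)⟩
  simp [fareyMid, hl, hz]

/-! ### The Farey plan -/

/-- The fractions that the Farey plan algorithm has met before the mediant of a Farey interval,
the last one first. -/
def fareyTrail : List Bool → List ℚ
  | [] => [1]
  | _ :: l => frac (fareyMid l) :: fareyTrail l

/-- The state of the Farey plan algorithm when it reaches the mediant of a Farey interval. -/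
def fareyState (l : List Bool) : FareyState :=
  ⟨(fareyTrail l).reverse, insert (frac (fareyMid l)) (insert 0 (fareyTrail l).toFinset),
    frac (fareyMid l)⟩

theorem fareyInterval_mem_fareyTrail (l : List Bool) :
    frac (fareyInterval l).1 ∈ insert 0 (fareyTrail l).toFinset ∧
      frac (fareyInterval l).2 ∈ insert 0 (fareyTrail l).toFinset := by
  induction l with
  | nil => simp [treeBasis, frac, fareyTrail]
  | cons b l ih =>
    rw [fareyTrail, List.toFinset_cons, Finset.insert_comm]
    cases b
    · exact ⟨Finset.mem_insert_self _ _, Finset.mem_insert_of_mem ih.2⟩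
    · exact ⟨Finset.mem_insert_of_mem ih.1, Finset.mem_insert_self _ _⟩

theorem le_or_le_of_mem_fareyTrail {l : List Bool} {x : ℚ}
    (hx : x ∈ insert 0 (fareyTrail l).toFinset) :
    x ≤ frac (fareyInterval l).1 ∨ frac (fareyInterval l).2 ≤ x := by
  induction l with
  | nil =>
    have : x = 0 ∨ x = 1 := by simpa [fareyTrail] using hx
    simpa [treeBasis, frac] using this.imp Eq.le Eq.ge
  | cons b l ih =>
    rw [fareyTrail, List.toFinset_cons, Finset.insert_comm, Finset.mem_insert] at hx
    cases b
    · exact hx.elim (fun h0 => .inl h0.le) fun hx =>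
        (ih hx).imp_left (fareyInterval_fst_lt_fareyMid l).le.trans'
    · exact hx.elim (fun h0 => .inr h0.ge) fun hx =>
        (ih hx).imp_right (fareyMid_lt_fareyInterval_snd l).le.trans

theorem notMem_fareyTrail {l : List Bool} {f : ℚ} (h1 : frac (fareyInterval l).1 < f)
    (h2 : f < frac (fareyInterval l).2) : f ∉ fareyTrail l := fun hf =>
  (le_or_le_of_mem_fareyTrail (Finset.mem_insert_of_mem (List.mem_toFinset.2 hf))).elim
    h1.not_ge h2.not_ge

theorem le_or_le_of_mem_fareyState {l : List Bool} {x : ℚ} (hx : x ∈ (fareyState l).X) :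
    x = frac (fareyMid l) ∨ x ≤ frac (fareyInterval l).1 ∨ frac (fareyInterval l).2 ≤ x :=
  (Finset.mem_insert.1 hx).imp_right le_or_le_of_mem_fareyTrail

theorem termBefore_fareyState (l : List Bool) :
    termBefore (fareyState l).X (frac (fareyMid l)) = frac (fareyInterval l).1 := by
  refine termBefore_eq (Finset.mem_insert_of_mem (fareyInterval_mem_fareyTrail l).1)
    (fareyInterval_fst_lt_fareyMid l) fun y hy hlt => ?_
  exact ((le_or_le_of_mem_fareyState hy).resolve_left hlt.ne).resolve_right
    (hlt.trans (fareyMid_lt_fareyInterval_snd l)).not_ge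

theorem termAfter_fareyState (l : List Bool) :
    termAfter (fareyState l).X (frac (fareyMid l)) = frac (fareyInterval l).2 := by
  refine termAfter_eq (Finset.mem_insert_of_mem (fareyInterval_mem_fareyTrail l).2)
    (fareyMid_lt_fareyInterval_snd l) fun y hy hlt => ?_
  exact ((le_or_le_of_mem_fareyState hy).resolve_left hlt.ne').resolve_left
    (hlt.trans' (fareyInterval_fst_lt_fareyMid l)).not_ge

theorem fareyState_cons (b : Bool) (l : List Bool) :
    fareyState (b :: l) = ⟨(fareyState l).C ++ [frac (fareyMid l)],
      insert (frac (fareyMid (b :: l))) (fareyState l).X, frac (fareyMid (b :: l))⟩ := by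
  rw [fareyState, fareyTrail, List.reverse_cons, List.toFinset_cons, Finset.insert_comm 0]
  rfl

theorem fareyStep_fareyState_of_lt {f : ℚ} {l : List Bool} (hf : f ∉ fareyTrail l)
    (hlt : f < frac (fareyMid l)) : fareyStep f (fareyState l) = fareyState (true :: l) := by
  have hC : f ∉ (fareyState l).C := mt List.mem_reverse.1 hf
  have hd : (fareyState l).d = frac (fareyMid l) := rfl
  have hmediant : mediant (frac (fareyMid l)) (frac (fareyInterval l).1) =
      frac (fareyMid (true :: l)) := by
    rw [mediant_comm]
    exact (isFareyPair_fareyInterval l).left.mediant_eq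
  simp only [fareyStep, if_neg hC, hd, if_neg hlt.not_gt, termBefore_fareyState, hmediant,
    fareyState_cons]

theorem fareyStep_fareyState_of_gt {f : ℚ} {l : List Bool} (hf : f ∉ fareyTrail l)
    (hgt : frac (fareyMid l) < f) : fareyStep f (fareyState l) = fareyState (false :: l) := by
  have hC : f ∉ (fareyState l).C := mt List.mem_reverse.1 hf
  have hd : (fareyState l).d = frac (fareyMid l) := rfl
  have hmediant : mediant (frac (fareyMid l)) (frac (fareyInterval l).2) =
      frac (fareyMid (false :: l)) := (isFareyPair_fareyInterval l).right.mediant_eq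
  simp only [fareyStep, if_neg hC, hd, if_pos hgt.gt, termAfter_fareyState, hmediant,
    fareyState_cons]

theorem fareyStep_init {f : ℚ} (hf : f < 1) :
    fareyStep f ⟨[], fareySeq 1, 1⟩ = fareyState [] := by
  have hbefore : termBefore {0, 1} 1 = 0 := termBefore_eq (by simp) one_pos (by simp)
  have hmediant : mediant 1 0 = frac (fareyMid []) := by
    simp [mediant, frac, fareyMid, treeVec, treeBasis]
  simp [fareyStep, hf.not_gt, hbefore, hmediant, fareySeq_one, fareyState, fareyTrail]

theorem iterate_fareyStep {f : ℚ} (l : List Bool) (h1 : frac (fareyInterval l).1 < f)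
    (h2 : f < frac (fareyInterval l).2) :
    (fareyStep f)^[l.length + 1] ⟨[], fareySeq 1, 1⟩ = fareyState l := by
  induction l with
  | nil => exact fareyStep_init (by simpa [treeBasis, frac] using h2)
  | cons b l ih =>
    rw [List.length_cons, Function.iterate_succ_apply']
    cases b
    · have h1' := (fareyInterval_fst_lt_fareyMid l).trans h1
      rw [ih h1' h2, fareyStep_fareyState_of_gt (notMem_fareyTrail (l := l) h1' h2) h1]
    · have h2' := h2.trans (fareyMid_lt_fareyInterval_snd l)
      rw [ih h1 h2', fareyStep_fareyState_of_lt (notMem_fareyTrail (l := l) h1 h2') h2]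

theorem iterate_fareyStep_fareyMid {l : List Bool} {n : ℕ} (hn : l.length + 2 ≤ n) :
    ((fareyStep (frac (fareyMid l)))^[n] ⟨[], fareySeq 1, 1⟩).C =
      (frac (fareyMid l) :: fareyTrail l).reverse := by
  have h1 := fareyInterval_fst_lt_fareyMid l
  have h2 := fareyMid_lt_fareyInterval_snd l
  have hC : frac (fareyMid l) ∉ (fareyState l).C := mt List.mem_reverse.1 (notMem_fareyTrail h1 h2)
  obtain ⟨m, rfl⟩ := Nat.exists_eq_add_of_le' hn
  rw [Function.iterate_add_apply, Function.iterate_succ_apply', iterate_fareyStep l h1 h2]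
  have hlast : (fareyStep (frac (fareyMid l)) (fareyState l)).C =
      (frac (fareyMid l) :: fareyTrail l).reverse := by
    rw [fareyStep, if_neg hC, List.reverse_cons]
    rfl
  rw [Function.iterate_fixed, hlast]
  rw [fareyStep, if_pos (by simp [hlast])]

/-! ### Edges and fractions -/

/-- The edge of a fraction `q` in the coordinate pair `i`; if `s` holds, then the denominator
of `q` is the first coordinate, otherwise the second one. -/
def edgeOf (i : Fin 3) (s : Bool) (q : ℚ) : Edge :=
  if s then ⟨i, q.den, q.num.natAbs, q.reduced.symm⟩ else ⟨i, q.num.natAbs, q.den, q.reduced⟩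

/-- The vector of the edge of a fraction, given as a pair (numerator, denominator). -/
def fracVec (i : Fin 3) (s : Bool) : ℕ × ℕ →+ Pt where
  toFun p := if s then p.2 • (coordPair i).1 + p.1 • (coordPair i).2
    else p.1 • (coordPair i).1 + p.2 • (coordPair i).2
  map_zero' := by simp
  map_add' p q := by cases s <;> simp [add_smul, add_add_add_comm]

section EdgeOf

variable (i : Fin 3) (s : Bool)

theorem vec_edgeOf (q : ℚ) : (edgeOf i s q).vec = fracVec i s (q.num.natAbs, q.den) := by
  cases s <;> simp only [edgeOf, Edge.vec, fracVec, natCast_zsmul] <;> rfl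

theorem vec_edgeOf_frac {p : ℕ × ℕ} (h : p.1.Coprime p.2) (hp : 0 < p.2) :
    (edgeOf i s (frac p)).vec = fracVec i s p := by
  rw [vec_edgeOf, num_frac h hp, den_frac h hp, Int.natAbs_natCast]

theorem toFarey_edgeOf {q : ℚ} (h0 : 0 ≤ q) (h1 : q ≤ 1) : (edgeOf i s q).toFarey = q := by
  have hle : q.num.natAbs ≤ q.den := by
    have := Rat.num_le_denom_iff.2 h1
    have := Rat.num_nonneg.2 h0
    omega
  have hq := frac_natAbs_num_den h0
  rw [frac] at hq
  cases s
  · rcases hle.lt_or_eq with hlt | heq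
    · simpa [edgeOf, Edge.toFarey, hlt] using hq
    · rw [heq] at hq
      simpa [edgeOf, Edge.toFarey, heq] using hq
  · simpa [edgeOf, Edge.toFarey, hle.not_gt] using hq

theorem ofFarey_edgeOf {q : ℚ} (h0 : 0 ≤ q) (h1 : q < 1) (r : ℚ) :
    (edgeOf i s q).ofFarey r = edgeOf i s r := by
  have hlt : q.num.natAbs < q.den := by
    have := Rat.num_lt_denom_iff.2 h1
    have := Rat.num_nonneg.2 h0
    omega
  cases s
  · simp [edgeOf, Edge.ofFarey, hlt]
  · simp [edgeOf, Edge.ofFarey, hlt.not_gt]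

theorem not_isUnit_edgeOf {q : ℚ} (hq : 0 < q) : ¬ (edgeOf i s q).IsUnit := by
  have := Int.natAbs_pos.2 (Rat.num_pos.2 hq).ne'
  have := q.den_pos
  cases s
  · simp only [edgeOf, Edge.IsUnit, Bool.false_eq_true, if_false]
    omega
  · simp only [edgeOf, Edge.IsUnit, if_true]
    omega

theorem neighbors_edgeOf_fareyMid (l : List Bool) :
    (edgeOf i s (frac (fareyMid l))).neighbors =
      (edgeOf i s (frac (fareyInterval l).1), edgeOf i s (frac (fareyInterval l).2)) := by
  have h := isFareyPair_fareyInterval l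
  have h0 := (frac_fareyMid_pos l).le
  have h1 := frac_fareyMid_lt_one l
  have hden : (frac (fareyMid l)).den = (fareyMid l).2 :=
    den_frac (coprime_fareyMid l) (den_fareyMid_pos l)
  have hne : ¬ ((edgeOf i s (frac (fareyMid l))).x = 1 ∧
      (edgeOf i s (frac (fareyMid l))).y = 1) := by
    have := length_add_two_le_den_fareyMid l
    cases s <;> simp only [edgeOf, hden, if_true, Bool.false_eq_true, if_false] <;> omega
  rw [Edge.neighbors, if_neg hne, toFarey_edgeOf i s h0 h1.le, hden, ofFarey_edgeOf i s h0 h1,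
    ofFarey_edgeOf i s h0 h1]
  exact congrArg₂ (fun a b => (edgeOf i s a, edgeOf i s b)) h.termBefore_fareySeq
    h.termAfter_fareySeq

theorem lenSq_fracVec (p : ℕ × ℕ) : lenSq (fracVec i s p) = p.1 ^ 2 + p.1 * p.2 + p.2 ^ 2 := by
  fin_cases i <;> cases s <;> simp [fracVec, coordPair, lenSq] <;> ring

theorem lenSq_fracVec_lt_add (p : ℕ × ℕ) {q : ℕ × ℕ} (hq : 0 < q.2) :
    lenSq (fracVec i s p) < lenSq (fracVec i s (p + q)) := by
  simp only [lenSq_fracVec, Prod.fst_add, Prod.snd_add]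
  norm_cast
  nlinarith [Nat.zero_le (p.1 * q.1), Nat.zero_le (p.2 * q.2), Nat.zero_le (p.1 * q.2),
    Nat.zero_le (p.2 * q.1), Nat.zero_le (q.1 * q.2)]

theorem vec_shorterNeighbor_edgeOf_fareyMid_cons (b : Bool) (l : List Bool) :
    (edgeOf i s (frac (fareyMid (b :: l)))).shorterNeighbor.vec =
      fracVec i s (treeShift (0, 1) (1, 1) b l) := by
  have h := isFareyPair_fareyInterval l
  have h' := isFareyPair_fareyInterval (b :: l)
  rw [Edge.shorterNeighbor, neighbors_edgeOf_fareyMid]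
  simp only [apply_ite Edge.vec, vec_edgeOf_frac i s h'.coprime_left h'.den_left_pos,
    vec_edgeOf_frac i s h'.coprime_right h'.den_right_pos]
  cases b
  · refine if_neg (not_le.2 ?_)
    rw [fareyInterval, treeBasis, add_comm]
    exact lenSq_fracVec_lt_add i s _ h.den_left_pos
  · exact if_pos (lenSq_fracVec_lt_add i s _ h.den_right_pos).le

theorem vec_shorterNeighbor_edgeOf_fareyMid_nil :
    (edgeOf i s (frac (fareyMid []))).shorterNeighbor.vec = fracVec i s (0, 1) := by
  have h := isFareyPair_fareyInterval []
  rw [Edge.shorterNeighbor, neighbors_edgeOf_fareyMid]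
  simp only [apply_ite Edge.vec, vec_edgeOf_frac i s h.coprime_left h.den_left_pos,
    vec_edgeOf_frac i s h.coprime_right h.den_right_pos]
  exact if_pos (by simp [lenSq_fracVec, treeBasis])

theorem reverse_fareyPlan_edgeOf_fareyMid (l : List Bool) :
    (fareyPlan (edgeOf i s (frac (fareyMid l)))).reverse = frac (fareyMid l) :: fareyTrail l := by
  have h0 := frac_fareyMid_pos l
  rw [fareyPlan, if_neg (not_isUnit_edgeOf i s h0),
    toFarey_edgeOf i s h0.le (frac_fareyMid_lt_one l).le, iterate_fareyStep_fareyMid,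
    List.reverse_reverse]
  rw [den_frac (coprime_fareyMid l) (den_fareyMid_pos l)]
  exact length_add_two_le_den_fareyMid l

theorem fareyPlan_edgeOf_one : fareyPlan (edgeOf i s 1) = [1] := by
  rw [fareyPlan, if_neg (not_isUnit_edgeOf i s one_pos), toFarey_edgeOf i s zero_le_one le_rfl]
  simp [fareyStep]

end EdgeOf

theorem exists_edgeOf_eq {e : Edge} (h : ¬ e.IsUnit) :
    ∃ s q, 0 < q ∧ q ≤ 1 ∧ e = edgeOf e.pair s q := by
  obtain ⟨i, x, y, hc⟩ := e
  have hx : 0 < x := Nat.pos_of_ne_zero fun hx => h (.inr ⟨hx, by simpa [hx] using hc⟩)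
  have hy : 0 < y := Nat.pos_of_ne_zero fun hy => h (.inl ⟨by simpa [hy] using hc, hy⟩)
  have key {a b : ℕ} (hab : a.Coprime b) (ha : 0 < a) (hb : 0 < b) (hle : a ≤ b) :
      0 < frac (a, b) ∧ frac (a, b) ≤ 1 ∧ (frac (a, b)).num.natAbs = a ∧
        (frac (a, b)).den = b := by
    rw [num_frac hab hb, den_frac hab hb, frac, div_le_one (by positivity)]
    exact ⟨by positivity, by exact_mod_cast hle, rfl, rfl⟩
  rcases le_total x y with hle | hle
  · obtain ⟨h0, h1, hnum, hden⟩ := key hc hx hy hle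
    exact ⟨false, _, h0, h1, by simp [edgeOf, hnum, hden]⟩
  · obtain ⟨h0, h1, hnum, hden⟩ := key hc.symm hy hx hle
    exact ⟨true, _, h0, h1, by simp [edgeOf, hnum, hden]⟩

/-! ### The flip plan as a tree of bases -/

/-- The vertex set of the parallelogram at `v` spanned by `p` and `q`. -/
def para (v p q : Pt) : Quad := {v, v + p, v + (p + q), v + q}

theorem insert_eq_para (v p q : Pt) :
    ({v + p, v + (p + q), v + q, v} : Finset Pt) = para v p q := by
  ext x
  simp only [para, Finset.mem_insert, Finset.mem_singleton]
  tauto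

theorem para_comm (v p q : Pt) : para v p q = para v q p := by
  ext x
  simp only [para, add_comm p q, Finset.mem_insert, Finset.mem_singleton]
  tauto

/-- The parallelogram at `v` spanned by a basis of the tree. -/
def treeQuad (U W : Pt) (l : List Bool) (v : Pt) : Quad :=
  para v (treeBasis U W l).1 (treeBasis U W l).2

/-- The flip plan in terms of the tree of bases: the children of a flip on the parallelogram of
the basis `b :: l` are the flips on two translates of the parallelogram of the basis `l`. -/
def treeDag (U W : Pt) : List Bool → Pt → FlipDag
  | [], v => ⟨{treeQuad U W [] v}, ∅⟩
  | b :: l, v =>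
    ⟨{treeQuad U W (b :: l) v} ∪ (treeDag U W l v).flips ∪
        (treeDag U W l (v + treeShift U W b l)).flips,
      {(treeQuad U W l v, treeQuad U W (b :: l) v),
        (treeQuad U W l (v + treeShift U W b l), treeQuad U W (b :: l) v)} ∪
        (treeDag U W l v).arcs ∪ (treeDag U W l (v + treeShift U W b l)).arcs⟩

/-- The path in the tree of bases of a coordinate pair that corresponds to a path of Farey
intervals, for the order of the coordinates given by `s`. -/
def treePath (s : Bool) (l : List Bool) : List Bool := l.map (· == s) ++ [s]

theorem eq_nil_or_exists_treePath_eq (l : List Bool) : l = [] ∨ ∃ s m, treePath s m = l := by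
  rcases List.eq_nil_or_concat l with rfl | ⟨m, s, rfl⟩
  · exact .inl rfl
  · refine .inr ⟨s, m.map (· == s), ?_⟩
    simp [treePath, Function.comp_def]

section CoordPair

variable (i : Fin 3) (s : Bool)

theorem treeBasis_treePath (l : List Bool) :
    treeBasis (coordPair i).1 (coordPair i).2 (treePath s l) =
      if s then (fareyInterval l).map (fracVec i s) (fracVec i s)
      else ((fareyInterval l).map (fracVec i s) (fracVec i s)).swap := by
  rw [treePath, treeBasis_append, fareyInterval, ← treeBasis_map]
  cases s
  · have : l.map (· == false) = l.map not := List.map_congr_left fun b _ => by cases b <;> rfl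
    rw [this, treeBasis_map_not]
    simp [treeBasis, fracVec]
  · simp [treeBasis, fracVec]

theorem treeVec_treePath (l : List Bool) :
    treeVec (coordPair i).1 (coordPair i).2 (treePath s l) = fracVec i s (fareyMid l) := by
  rw [treeVec, treeBasis_treePath, fareyMid, treeVec, map_add]
  cases s
  · exact add_comm _ _
  · rfl

theorem treeShift_treePath (b : Bool) (l : List Bool) :
    treeShift (coordPair i).1 (coordPair i).2 (b == s) (treePath s l) =
      fracVec i s (treeShift (0, 1) (1, 1) b l) := by
  rw [treeShift, treeBasis_treePath]
  cases s <;> cases b <;> rfl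

theorem fareyParallelogram_edgeOf_fareyMid (l : List Bool) (v : Pt) :
    fareyParallelogram (edgeOf i s (frac (fareyMid l))) v =
      treeQuad (coordPair i).1 (coordPair i).2 (treePath s l) v := by
  have h := isFareyPair_fareyInterval l
  rw [fareyParallelogram, neighbors_edgeOf_fareyMid,
    vec_edgeOf_frac i s h.coprime_left h.den_left_pos,
    vec_edgeOf_frac i s h.coprime_right h.den_right_pos,
    vec_edgeOf_frac i s (coprime_fareyMid l) (den_fareyMid_pos l), fareyMid, treeVec, map_add,
    treeQuad, treeBasis_treePath]
  cases s
  · exact para_comm _ _ _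
  · rfl

theorem fareyParallelogram_edgeOf_one (v : Pt) :
    fareyParallelogram (edgeOf i s 1) v = treeQuad (coordPair i).1 (coordPair i).2 [] v := by
  have hneighbors : (edgeOf i s 1).neighbors =
      (⟨i, 0, 1, by simp⟩, ⟨i, 1, 0, by simp⟩) := by
    cases s <;> simp [Edge.neighbors, edgeOf]
  have hvec : (edgeOf i s 1).vec = (coordPair i).2 + (coordPair i).1 := by
    rw [vec_edgeOf]
    cases s <;> simp [fracVec, add_comm]
  rw [fareyParallelogram, hneighbors, hvec, treeQuad, para_comm]
  simp [para, Edge.vec, treeBasis]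

theorem flipDag_cons_cons (x g : ℚ) (C : List ℚ) (e : Edge) (v : Pt) :
    flipDag (x :: g :: C) e v =
      ⟨{fareyParallelogram e v} ∪ (flipDag (g :: C) (e.ofFarey g) v).flips ∪
          (flipDag (g :: C) (e.ofFarey g) (v + e.shorterNeighbor.vec)).flips,
        {(fareyParallelogram (e.ofFarey g) v, fareyParallelogram e v),
          (fareyParallelogram (e.ofFarey g) (v + e.shorterNeighbor.vec),
            fareyParallelogram e v)} ∪ (flipDag (g :: C) (e.ofFarey g) v).arcs ∪
          (flipDag (g :: C) (e.ofFarey g) (v + e.shorterNeighbor.vec)).arcs⟩ := rfl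

theorem flipDag_edgeOf_one (v : Pt) :
    flipDag [1] (edgeOf i s 1) v = treeDag (coordPair i).1 (coordPair i).2 [] v := by
  simp only [flipDag, treeDag, fareyParallelogram_edgeOf_one]

theorem flipDag_edgeOf_fareyMid (l : List Bool) (x : ℚ) (v : Pt) :
    flipDag (x :: fareyTrail l) (edgeOf i s (frac (fareyMid l))) v =
      treeDag (coordPair i).1 (coordPair i).2 (treePath s l) v := by
  induction l generalizing x v with
  | nil =>
    have hshift : treeShift (coordPair i).1 (coordPair i).2 s [] = fracVec i s (0, 1) := by
      cases s <;> simp [treeShift, treeBasis, fracVec]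
    rw [fareyTrail, flipDag_cons_cons,
      ofFarey_edgeOf i s (frac_fareyMid_pos _).le (frac_fareyMid_lt_one _),
      vec_shorterNeighbor_edgeOf_fareyMid_nil, ← hshift]
    simp only [flipDag_edgeOf_one, fareyParallelogram_edgeOf_fareyMid,
      fareyParallelogram_edgeOf_one]
    rfl
  | cons b l ih =>
    rw [fareyTrail, flipDag_cons_cons,
      ofFarey_edgeOf i s (frac_fareyMid_pos _).le (frac_fareyMid_lt_one _),
      vec_shorterNeighbor_edgeOf_fareyMid_cons, ← treeShift_treePath]
    simp only [ih, fareyParallelogram_edgeOf_fareyMid]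
    rfl

end CoordPair

theorem exists_flipDag_eq_treeDag {e : Edge} (h : ¬ e.IsUnit) :
    ∃ l, e.vec = treeVec (coordPair e.pair).1 (coordPair e.pair).2 l ∧
      ∀ v, flipDag (fareyPlan e).reverse e v =
        treeDag (coordPair e.pair).1 (coordPair e.pair).2 l v := by
  obtain ⟨s, q, h0, h1, he⟩ := exists_edgeOf_eq h
  generalize e.pair = i at he ⊢
  subst he
  rcases h1.lt_or_eq with hlt | rfl
  · obtain ⟨l, rfl⟩ := exists_frac_fareyMid_eq h0 hlt
    refine ⟨treePath s l, ?_, fun v => ?_⟩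
    · rw [vec_edgeOf_frac i s (coprime_fareyMid l) (den_fareyMid_pos l), treeVec_treePath]
    · rw [reverse_fareyPlan_edgeOf_fareyMid, flipDag_edgeOf_fareyMid]
  · refine ⟨[], ?_, fun v => ?_⟩
    · rw [vec_edgeOf]
      cases s <;> simp [fracVec, treeVec, treeBasis]
    · rw [fareyPlan_edgeOf_one, List.reverse_singleton, flipDag_edgeOf_one]

theorem exists_treeQuad_eq_fareyParallelogram (i : Fin 3) (l : List Bool) (v : Pt) :
    ∃ g : Edge, ¬ g.IsUnit ∧
      treeQuad (coordPair i).1 (coordPair i).2 l v = fareyParallelogram g v := by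
  rcases eq_nil_or_exists_treePath_eq l with rfl | ⟨s, m, rfl⟩
  · exact ⟨_, not_isUnit_edgeOf i true one_pos, (fareyParallelogram_edgeOf_one i true v).symm⟩
  · exact ⟨_, not_isUnit_edgeOf i s (frac_fareyMid_pos m),
      (fareyParallelogram_edgeOf_fareyMid i s m v).symm⟩

/-! ### Unimodular triangles -/

/-- The determinant of two lattice vectors in lattice coordinates, so that two vectors are a basis
of the lattice if and only if it is `1` or `-1`. -/
def cross (p q : Pt) : ℤ := p.1 * q.2 - p.2 * q.1

@[simp] theorem cross_self (p : Pt) : cross p p = 0 := by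
  rw [cross, mul_comm, sub_self]

@[simp] theorem cross_zero (p : Pt) : cross p 0 = 0 := by simp [cross]

@[simp] theorem zero_cross (p : Pt) : cross 0 p = 0 := by simp [cross]

@[simp] theorem cross_add_left (p p' q : Pt) : cross (p + p') q = cross p q + cross p' q := by
  simp only [cross, Prod.fst_add, Prod.snd_add]; ring

@[simp] theorem cross_add_right (p q q' : Pt) : cross p (q + q') = cross p q + cross p q' := by
  simp only [cross, Prod.fst_add, Prod.snd_add]; ring

@[simp] theorem cross_neg_left (p q : Pt) : cross (-p) q = -cross p q := by
  simp only [cross, Prod.fst_neg, Prod.snd_neg]; ring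

@[simp] theorem cross_neg_right (p q : Pt) : cross p (-q) = -cross p q := by
  simp only [cross, Prod.fst_neg, Prod.snd_neg]; ring

theorem cross_sub_left (p p' q : Pt) : cross (p - p') q = cross p q - cross p' q := by
  rw [sub_eq_add_neg, cross_add_left, cross_neg_left, sub_eq_add_neg]

theorem cross_sub_right (p q q' : Pt) : cross p (q - q') = cross p q - cross p q' := by
  rw [sub_eq_add_neg, cross_add_right, cross_neg_right, sub_eq_add_neg]

theorem cross_smul_right (k : ℤ) (p q : Pt) : cross p (k • q) = k * cross p q := by
  simp only [cross, Prod.smul_fst, Prod.smul_snd, smul_eq_mul]; ring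

theorem cross_swap (p q : Pt) : cross q p = -cross p q := by
  simp only [cross]; ring

/-- The vertex set of the triangle at `w` spanned by `p` and `q`. -/
def tri (w p q : Pt) : Finset Pt := {w, w + p, w + q}

theorem mem_tri {w p q z : Pt} : z ∈ tri w p q ↔ z = w ∨ z = w + p ∨ z = w + q := by
  simp [tri]

theorem mem_tri_opposite {w p q z : Pt} :
    z ∈ tri (w + (p + q)) (-p) (-q) ↔ z = w + (p + q) ∨ z = w + q ∨ z = w + p := by
  rw [mem_tri, show w + (p + q) + -p = w + q by abel, show w + (p + q) + -q = w + p by abel]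

theorem insert_eq_tri (w p q : Pt) : ({w + p, w + q, w} : Finset Pt) = tri w p q := by
  ext z
  simp only [mem_tri, Finset.mem_insert, Finset.mem_singleton]
  tauto

theorem insert_eq_tri_opposite (w p q : Pt) :
    ({w + p, w + (p + q), w + q} : Finset Pt) = tri (w + (p + q)) (-p) (-q) := by
  ext z
  simp only [mem_tri_opposite, Finset.mem_insert, Finset.mem_singleton]
  tauto

theorem tri_opposite_left (w p q : Pt) :
    tri (w + (p + q)) (-p) (-p + -q) = tri w (p + q) q := by
  ext z
  rw [mem_tri, mem_tri, show w + (p + q) + -p = w + q by abel,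
    show w + (p + q) + (-p + -q) = w by abel]
  tauto

theorem tri_opposite_right (w p q : Pt) :
    tri (w + (p + q)) (-p + -q) (-q) = tri w p (p + q) := by
  ext z
  rw [mem_tri, mem_tri, show w + (p + q) + -q = w + p by abel,
    show w + (p + q) + (-p + -q) = w by abel]
  tauto

theorem mem_para {w p q z : Pt} :
    z ∈ para w p q ↔ z = w ∨ z = w + p ∨ z = w + (p + q) ∨ z = w + q := by
  simp [para]

theorem tri_subset_para (w p q : Pt) : tri w p q ⊆ para w p q := by
  intro z hz
  rw [mem_para]
  rcases mem_tri.1 hz with h | h | h <;> simp only [h, true_or, or_true]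

theorem tri_opposite_subset_para (w p q : Pt) :
    tri (w + (p + q)) (-p) (-q) ⊆ para w p q := by
  intro z hz
  rw [mem_para]
  rcases mem_tri_opposite.1 hz with h | h | h <;> simp only [h, true_or, or_true]

theorem tri_opposite_opposite (w p q : Pt) :
    tri (w + (p + q) + (-p + -q)) (- -p) (- -q) = tri w p q := by
  rw [neg_neg, neg_neg, show w + (p + q) + (-p + -q) = w by abel]

/-- The signed area of the parallelogram spanned by `p` and `x - w`. Its sign tells on which side of
the line through `w` in the direction `p` the point `x` lies. If `cross p q = 1`, then
`-side w q x` and `side w p x` are the coordinates of `x - w` with respect to `p` and `q`. -/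
def side (w p : Pt) (x : Plane) : ℝ := p.1 * (x.2 - w.2) - p.2 * (x.1 - w.1)

@[simp] theorem side_toPlane (w p z : Pt) : side w p (toPlane z) = cross p (z - w) := by
  simp [side, toPlane, cross]

theorem side_add (w p q : Pt) (x : Plane) : side w (p + q) x = side w p x + side w q x := by
  simp only [side, Prod.fst_add, Prod.snd_add, Int.cast_add]; ring

theorem side_sub (w p q : Pt) (x : Plane) : side w (p - q) x = side w p x - side w q x := by
  simp only [side, Prod.fst_sub, Prod.snd_sub, Int.cast_sub]; ring

theorem side_add_neg (w p r : Pt) (x : Plane) :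
    side (w + r) (-p) x = cross p r - side w p x := by
  simp only [side, cross, Prod.fst_add, Prod.snd_add, Prod.fst_neg, Prod.snd_neg, Int.cast_add,
    Int.cast_neg, Int.cast_sub, Int.cast_mul]
  ring

theorem side_eq_sub (w z p : Pt) (x : Plane) : side z p x = side w p x - cross p (z - w) := by
  simp only [side, cross, Prod.fst_sub, Prod.snd_sub, Int.cast_sub, Int.cast_mul]
  ring

theorem side_combo (w p : Pt) (x y : Plane) {a b : ℝ} (h : a + b = 1) :
    side w p (a • x + b • y) = a * side w p x + b * side w p y := by
  obtain rfl := eq_sub_of_add_eq h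
  simp only [side, Prod.fst_add, Prod.snd_add, Prod.smul_fst, Prod.smul_snd, smul_eq_mul]
  ring

theorem hull_mono {s t : Finset Pt} (h : s ⊆ t) : hull s ⊆ hull t :=
  convexHull_mono (Set.image_mono (by exact_mod_cast h))

theorem toPlane_mem_hull {s : Finset Pt} {a : Pt} (h : a ∈ s) : toPlane a ∈ hull s :=
  subset_convexHull _ _ ⟨a, h, rfl⟩

theorem convex_hull (s : Finset Pt) : Convex ℝ (hull s) := convex_convexHull _ _

theorem combo_mem_hull_tri {w p q : Pt} {a b c : ℝ} (ha : 0 ≤ a) (hb : 0 ≤ b) (hc : 0 ≤ c)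
    (h : a + b + c = 1) :
    a • toPlane w + b • toPlane (w + p) + c • toPlane (w + q) ∈ hull (tri w p q) := by
  have := (convex_hull (tri w p q)).sum_mem (t := Finset.univ) (w := ![a, b, c])
    (z := ![toPlane w, toPlane (w + p), toPlane (w + q)])
    (by intro i _; fin_cases i <;> assumption)
    (by simpa only [Fin.sum_univ_three, Matrix.cons_val] using h)
    (by intro i _; fin_cases i <;> exact toPlane_mem_hull (by simp [tri]))
  simpa only [Fin.sum_univ_three, Matrix.cons_val] using this

theorem hull_inter_subset (s t : Finset Pt) : hull (s ∩ t) ⊆ hull s ∩ hull t :=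
  Set.subset_inter (hull_mono Finset.inter_subset_left) (hull_mono Finset.inter_subset_right)

theorem le_side_of_mem_hull {s : Finset Pt} {w p : Pt} {c : ℤ} (h : ∀ z ∈ s, c ≤ cross p (z - w))
    {x : Plane} (hx : x ∈ hull s) : c ≤ side w p x := by
  refine convexHull_min (t := {x | c ≤ side w p x}) ?_ ?_ hx
  · rintro _ ⟨z, hz, rfl⟩
    rw [Set.mem_ofPred_eq, side_toPlane]
    exact_mod_cast h z hz
  · intro x hx y hy a b ha hb hab
    rw [Set.mem_ofPred_eq, side_combo w p x y hab]
    calc (c : ℝ) = a * c + b * c := by rw [← add_mul, hab, one_mul]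
      _ ≤ _ := add_le_add (mul_le_mul_of_nonneg_left hx ha) (mul_le_mul_of_nonneg_left hy hb)

theorem mem_hull_filter_of_side_nonpos {s : Finset Pt} {w p : Pt}
    (h : ∀ z ∈ s, 0 ≤ cross p (z - w)) {x : Plane} (hx : x ∈ hull s) (hside : side w p x ≤ 0) :
    x ∈ hull (s.filter fun z => cross p (z - w) = 0) := by
  have hmain : x ∈ {x | 0 ≤ side w p x ∧
      (side w p x ≤ 0 → x ∈ hull (s.filter fun z => cross p (z - w) = 0))} := by
    refine convexHull_min ?_ (convex_iff_forall_pos.2 ?_) hx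
    · rintro _ ⟨z, hz, rfl⟩
      rw [Set.mem_ofPred_eq, side_toPlane]
      refine ⟨by exact_mod_cast h z hz, fun h0 => toPlane_mem_hull ?_⟩
      exact Finset.mem_filter.2 ⟨hz, le_antisymm (by exact_mod_cast h0) (h z hz)⟩
    · rintro x ⟨hx, hx'⟩ y ⟨hy, hy'⟩ a b ha hb hab
      have hax := mul_nonneg ha.le hx
      have hby := mul_nonneg hb.le hy
      rw [Set.mem_ofPred_eq, side_combo w p x y hab]
      refine ⟨add_nonneg hax hby, fun h0 => convex_hull _ (hx' ?_) (hy' ?_) ha.le hb.le hab⟩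
      · exact nonpos_of_mul_nonpos_right (by linarith) ha
      · exact nonpos_of_mul_nonpos_right (by linarith) hb
  exact hmain.2 hside

section Triangle

variable {w p q : Pt} (h : cross p q = 1)
include h

theorem smul_toPlane_combo (x : Plane) :
    (1 + side w q x - side w p x) • toPlane w + -side w q x • toPlane (w + p) +
      side w p x • toPlane (w + q) = x := by
  have h' : (p.1 : ℝ) * q.2 - p.2 * q.1 = 1 := by exact_mod_cast h
  ext
  · simp only [side, toPlane, Prod.fst_add, Prod.snd_add, Prod.smul_fst, smul_eq_mul, Int.cast_add]
    linear_combination (x.1 - w.1) * h'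
  · simp only [side, toPlane, Prod.fst_add, Prod.snd_add, Prod.smul_snd, smul_eq_mul, Int.cast_add]
    linear_combination (x.2 - w.2) * h'

theorem mem_hull_tri {x : Plane} :
    x ∈ hull (tri w p q) ↔
      side w q x ≤ 0 ∧ 0 ≤ side w p x ∧ side w p x - side w q x ≤ 1 := by
  have hqp : cross q p = -1 := by rw [cross_swap, h]
  constructor
  · intro hx
    have h1 : ((0 : ℤ) : ℝ) ≤ side (w + 0) (-q) x := le_side_of_mem_hull (by simp [tri, hqp]) hx
    have h2 : ((0 : ℤ) : ℝ) ≤ side w p x := le_side_of_mem_hull (by simp [tri, h]) hx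
    have h3 : ((-1 : ℤ) : ℝ) ≤ side (w + 0) (-(p - q)) x :=
      le_side_of_mem_hull (by simp [tri, cross_sub_left, h, hqp]) hx
    rw [side_add_neg, cross_zero] at h1 h3
    rw [side_sub] at h3
    push_cast at h1 h2 h3
    exact ⟨by linarith, h2, by linarith⟩
  · rintro ⟨h1, h2, h3⟩
    rw [← smul_toPlane_combo (w := w) h x]
    exact combo_mem_hull_tri (by linarith) (by linarith) h2 (by ring)

theorem mem_hull_tri_opposite {x : Plane} :
    x ∈ hull (tri (w + (p + q)) (-p) (-q)) ↔
      -1 ≤ side w q x ∧ side w p x ≤ 1 ∧ 1 ≤ side w p x - side w q x := by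
  have hqp : cross q p = -1 := by rw [cross_swap, h]
  rw [mem_hull_tri (by simpa using h)]
  simp only [side_add_neg, cross_add_right, cross_self, h, hqp]
  push_cast
  constructor <;> rintro ⟨h1, h2, h3⟩ <;> refine ⟨?_, ?_, ?_⟩ <;> linarith

theorem mem_hull_tri_right {x : Plane} :
    x ∈ hull (tri w p (p + q)) ↔
      side w p x + side w q x ≤ 0 ∧ 0 ≤ side w p x ∧ -1 ≤ side w q x := by
  rw [mem_hull_tri (by simpa using h), side_add]
  constructor <;> rintro ⟨h1, h2, h3⟩ <;> refine ⟨?_, ?_, ?_⟩ <;> linarith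

theorem mem_hull_tri_left {x : Plane} :
    x ∈ hull (tri w (p + q) q) ↔
      side w q x ≤ 0 ∧ 0 ≤ side w p x + side w q x ∧ side w p x ≤ 1 := by
  rw [mem_hull_tri (by simpa using h), side_add]
  constructor <;> rintro ⟨h1, h2, h3⟩ <;> refine ⟨?_, ?_, ?_⟩ <;> linarith

theorem hull_tri_union_hull_tri_opposite :
    hull (tri w p q) ∪ hull (tri (w + (p + q)) (-p) (-q)) =
      hull (tri w p (p + q)) ∪ hull (tri w (p + q) q) := by
  ext x
  simp only [Set.mem_union, mem_hull_tri h, mem_hull_tri_opposite h, mem_hull_tri_right h,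
    mem_hull_tri_left h]
  constructor
  · rintro (⟨h1, h2, h3⟩ | ⟨h1, h2, h3⟩) <;>
      rcases le_total (side w p x + side w q x) 0 with hd | hd
    all_goals first
      | exact .inl ⟨by linarith, by linarith, by linarith⟩
      | exact .inr ⟨by linarith, by linarith, by linarith⟩
  · rintro (⟨h1, h2, h3⟩ | ⟨h1, h2, h3⟩) <;>
      rcases le_total (side w p x - side w q x) 1 with hd | hd
    all_goals first
      | exact .inl ⟨by linarith, by linarith, by linarith⟩
      | exact .inr ⟨by linarith, by linarith, by linarith⟩

theorem hull_tri_right_inter_hull_tri_left :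
    hull (tri w p (p + q)) ∩ hull (tri w (p + q) q) =
      hull (tri w p (p + q) ∩ tri w (p + q) q) := by
  refine (Set.Subset.antisymm (hull_inter_subset _ _) ?_).symm
  rintro x ⟨h1, h2⟩
  have hqp : cross q p = -1 := by rw [cross_swap, h]
  have hside : side w (p + q) x ≤ 0 := side_add w p q x ▸ ((mem_hull_tri_right h).1 h1).1
  refine hull_mono ?_ (mem_hull_filter_of_side_nonpos ?_ h2 hside)
  · intro z hz
    obtain ⟨hz, h0⟩ := Finset.mem_filter.1 hz
    rcases mem_tri.1 hz with rfl | rfl | rfl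
    · simp [tri]
    · simp [tri]
    · simp [h] at h0
  · simp [tri, h, hqp]

end Triangle

theorem linearIndependent_toPlane_pair {p q : Pt} :
    LinearIndependent ℝ ![toPlane p, toPlane q] ↔ cross p q ≠ 0 := by
  rw [LinearIndependent.pair_iff]
  have hcast : (cross p q : ℝ) = p.1 * q.2 - p.2 * q.1 := by simp [cross]
  constructor
  · intro hind h0
    rw [h0, Int.cast_zero] at hcast
    have h1 := hind q.2 (-p.2) (by ext <;> simp [toPlane] <;> linarith)
    have h2 := hind q.1 (-p.1) (by ext <;> simp [toPlane] <;> linarith)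
    have hp : toPlane p = 0 := by
      ext
      · simpa [toPlane] using h2.2
      · simpa [toPlane] using h1.2
    simpa using hind 1 0 (by simp [hp])
  · intro h0 s t hst
    have h1 : s * p.1 + t * q.1 = 0 := by simpa [toPlane] using congrArg Prod.fst hst
    have h2 : s * p.2 + t * q.2 = 0 := by simpa [toPlane] using congrArg Prod.snd hst
    have h0' : (cross p q : ℝ) ≠ 0 := by exact_mod_cast h0
    constructor
    · refine (mul_eq_zero_iff_right h0').1 ?_
      linear_combination s * hcast + (q.2 : ℝ) * h1 - (q.1 : ℝ) * h2
    · refine (mul_eq_zero_iff_right h0').1 ?_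
      linear_combination t * hcast + (p.1 : ℝ) * h2 - (p.2 : ℝ) * h1

theorem affineIndependent_triple {a b c : Pt} (hab : a ≠ b) (hac : a ≠ c) (hbc : b ≠ c) :
    AffineIndependent ℝ (fun z : ({a, b, c} : Finset Pt) => toPlane z) ↔
      cross (b - a) (c - a) ≠ 0 := by
  let f : Fin 3 → ({a, b, c} : Finset Pt) := ![⟨a, by simp⟩, ⟨b, by simp⟩, ⟨c, by simp⟩]
  have hf : Function.Bijective f := by
    refine (Fintype.bijective_iff_injective_and_card f).2 ⟨fun i j h => ?_, ?_⟩
    · fin_cases i <;> fin_cases j <;> simp_all [f]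
    · rw [Fintype.card_coe, Fintype.card_fin, Finset.card_eq_three.2 ⟨a, b, c, hab, hac, hbc, rfl⟩]
  rw [← linearIndependent_toPlane_pair, ← affineIndependent_equiv (Equiv.ofBijective f hf),
    affineIndependent_iff_linearIndependent_vsub ℝ _ (0 : Fin 3),
    ← linearIndependent_equiv (finSuccAboveEquiv (0 : Fin 3))]
  have he : ![toPlane (b - a), toPlane (c - a)] =
      fun i => toPlane (f i.succ) - toPlane (f 0) := by
    ext i <;> fin_cases i <;> simp [f, toPlane]
  rw [he]
  rfl

theorem ne_of_cross_ne_zero {w p q : Pt} (h : cross p q ≠ 0) :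
    w ≠ w + p ∧ w ≠ w + q ∧ w + p ≠ w + q := by
  refine ⟨?_, ?_, ?_⟩ <;> intro he
  · simp [left_eq_add.1 he, cross] at h
  · simp [left_eq_add.1 he, cross] at h
  · simp [add_left_cancel he] at h

theorem card_tri {w p q : Pt} (h : cross p q ≠ 0) : (tri w p q).card = 3 :=
  have ⟨h1, h2, h3⟩ := ne_of_cross_ne_zero h
  Finset.card_eq_three.2 ⟨_, _, _, h1, h2, h3, rfl⟩

theorem affineIndependent_tri {w p q : Pt} (h : cross p q ≠ 0) :
    AffineIndependent ℝ (fun z : tri w p q => toPlane z) :=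
  have ⟨h1, h2, h3⟩ := ne_of_cross_ne_zero h
  (affineIndependent_triple h1 h2 h3).2 (by simpa using h)

/-! ### Flips on unimodular parallelograms -/

variable {Ω : Set Plane}

theorem Triangulation.mem_of_toPlane_mem_hull (T : Triangulation Ω) {t : Finset Pt}
    (ht : t ∈ T.triangles) {p : Pt} (h : toPlane p ∈ hull t) : p ∈ t := by
  obtain ⟨s, hs, hps⟩ := T.full p (T.cover ▸ Set.mem_biUnion ht h)
  have hface : toPlane p ∈ hull (s ∩ t) := by
    rw [← T.inter_eq s hs t ht]
    exact ⟨toPlane_mem_hull hps, h⟩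
  apply ((T.affineIndependent s hs).mem_affineSpan_iff ⟨p, hps⟩ {x : s | (x : Pt) ∈ t}).1
  refine convexHull_subset_affineSpan _ (convexHull_mono ?_ hface)
  rintro _ ⟨x, hx, rfl⟩
  rw [Finset.mem_coe, Finset.mem_inter] at hx
  exact ⟨⟨x, hx.1⟩, hx.2, rfl⟩

theorem eq_tri_of_mem {t : Finset Pt} (ht : t.card = 3) {w p q : Pt} (h : cross p q ≠ 0)
    (hw : w ∈ t) (hp : w + p ∈ t) (hq : w + q ∈ t) : t = tri w p q := by
  refine (Finset.eq_of_subset_of_card_le (fun z hz => ?_) ?_).symm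
  · rcases mem_tri.1 hz with rfl | rfl | rfl <;> assumption
  · rw [ht, card_tri h]

/-- Take `y` close to the midpoint of the segment from `w + p` to `w + q`. -/
theorem exists_mem_hull_of_cross_nonpos {w p q z : Pt} (h : cross p q = 1)
    (hz : cross (p - q) (z - w) ≤ 0) :
    ∃ y ∈ hull {w + p, w + q, z}, y ∈ hull (tri w p q) ∧ side w (p - q) y < 1 := by
  have hqp : cross q p = -1 := by rw [cross_swap, h]
  have hsmall (c : ℝ) : ∀ᶠ ε in nhdsWithin (0 : ℝ) (Set.Ioi 0), 0 < (1 - ε) * (1 / 2) + ε * c :=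
    (((by fun_prop : Continuous fun ε : ℝ => (1 - ε) * (1 / 2) + ε * c).tendsto 0).mono_left
      nhdsWithin_le_nhds).eventually_const_lt (by norm_num)
  obtain ⟨ε, ⟨hεp, hεq⟩, hε0, hε1⟩ := (((hsmall (cross p (z - w))).and
    (hsmall (-cross q (z - w)))).and (Ioo_mem_nhdsGT (one_pos (α := ℝ)))).exists
  set m : Plane := (1 / 2 : ℝ) • toPlane (w + p) + (1 / 2 : ℝ) • toPlane (w + q) with hm
  have hyp : side w p ((1 - ε) • m + ε • toPlane z) =
      (1 - ε) * (1 / 2) + ε * cross p (z - w) := by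
    rw [side_combo _ _ _ _ (by ring), hm, side_combo _ _ _ _ (by norm_num)]
    simp [h]
  have hyq : side w q ((1 - ε) • m + ε • toPlane z) =
      -((1 - ε) * (1 / 2) + ε * -cross q (z - w)) := by
    rw [side_combo _ _ _ _ (by ring), hm, side_combo _ _ _ _ (by norm_num)]
    simp [hqp, add_comm]
  have hlt : side w (p - q) ((1 - ε) • m + ε • toPlane z) < 1 := by
    have : (cross p (z - w) - cross q (z - w) : ℝ) ≤ 0 := by
      rw [cross_sub_left] at hz
      exact_mod_cast hz
    rw [side_sub, hyp, hyq]
    nlinarith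
  refine ⟨(1 - ε) • m + ε • toPlane z, ?_, (mem_hull_tri h).2 ⟨?_, hyp ▸ hεp.le, ?_⟩, hlt⟩
  · exact convex_hull _ (convex_hull _ (toPlane_mem_hull (by simp)) (toPlane_mem_hull (by simp))
      (by norm_num) (by norm_num) (by norm_num)) (toPlane_mem_hull (by simp)) (by linarith) hε0.le
      (by ring)
  · rw [hyq]
    exact neg_nonpos.2 hεq.le
  · exact side_sub w p q _ ▸ hlt.le

theorem Triangulation.one_le_cross_of_share_side (T : Triangulation Ω) {w p q : Pt}
    (h : cross p q = 1) (htri : tri w p q ∈ T.triangles) {t : Finset Pt} (ht : t ∈ T.triangles)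
    (hne : t ≠ tri w p q) (hp : w + p ∈ t) (hq : w + q ∈ t) {z : Pt} (hz : z ∈ t) :
    1 ≤ cross (p - q) (z - w) := by
  by_contra! hlt
  have hqp : cross q p = -1 := by rw [cross_swap, h]
  have hw : w ∉ t := fun hw =>
    hne (eq_tri_of_mem (T.card_eq_three t ht) (by simp [h]) hw hp hq)
  obtain ⟨y, hy, hytri, hylt⟩ := exists_mem_hull_of_cross_nonpos h (Int.lt_add_one_iff.1 hlt)
  have hyt : y ∈ hull t := hull_mono (by simp [Finset.insert_subset_iff, hp, hq, hz]) hy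
  have hface : y ∈ hull (tri w p q ∩ t) := T.inter_eq _ htri _ ht ▸ ⟨hytri, hyt⟩
  refine hylt.not_ge (mod_cast le_side_of_mem_hull (c := 1) (fun x hx => ?_) hface)
  obtain ⟨hx, hxt⟩ := Finset.mem_inter.1 hx
  rcases mem_tri.1 hx with rfl | rfl | rfl
  · exact absurd hxt hw
  · simp [cross_sub_left, hqp]
  · simp [cross_sub_left, h]

section Flip

variable (T : Triangulation Ω) {w p q : Pt} (h : cross p q = 1)
  (hlower : tri w p q ∈ T.triangles) (hupper : tri (w + (p + q)) (-p) (-q) ∈ T.triangles)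
include h hlower hupper

theorem Triangulation.eq_or_eq_of_share_side {t : Finset Pt} (ht : t ∈ T.triangles)
    (hp : w + p ∈ t) (hq : w + q ∈ t) : t = tri w p q ∨ t = tri (w + (p + q)) (-p) (-q) := by
  by_contra! hne
  have hqp : cross q p = -1 := by rw [cross_swap, h]
  have hpq : w + p ≠ w + q := (ne_of_cross_ne_zero (w := w) (by simp [h])).2.2
  obtain ⟨z, hz, hzpq⟩ := Finset.exists_mem_notMem_of_card_lt_card (s := {w + p, w + q}) (t := t)
    (by rw [T.card_eq_three t ht]; exact Finset.card_le_two.trans_lt (by norm_num))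
  obtain ⟨hzp, hzq⟩ : z ≠ w + p ∧ z ≠ w + q := by simpa using hzpq
  obtain rfl : {w + p, w + q, z} = t := by
    refine Finset.eq_of_subset_of_card_le (by simp [Finset.insert_subset_iff, hp, hq, hz]) ?_
    rw [T.card_eq_three _ ht, Finset.card_eq_three.2 ⟨_, _, _, hpq, hzp.symm, hzq.symm, rfl⟩]
  have hle := T.one_le_cross_of_share_side h hlower ht hne.1 hp hq hz
  have hge := T.one_le_cross_of_share_side (by simpa using h) hupper ht hne.2
    (by simp [add_assoc]) (by simp [add_assoc]) hz
  apply (affineIndependent_triple hpq hzp.symm hzq.symm).1 (T.affineIndependent _ ht)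
  have e1 : w + q - (w + p) = -(p - q) := by abel
  have e2 : z - (w + p) = z - w - p := by abel
  have e3 : z - (w + (p + q)) = z - w - (p + q) := by abel
  simp only [e1, e2, e3, cross_sub_left, cross_sub_right, cross_neg_left, cross_add_right,
    cross_self, h, hqp] at hle hge ⊢
  omega

/-- If `t` does not contain `w + q`, the new triangle contains all vertices that `t` shares with the
old ones. If it does not contain `w + p`, the diagonal from `w` to `w + (p + q)` supports the part
of the old triangles that `t` meets. -/
theorem Triangulation.hull_tri_right_inter {t : Finset Pt} (ht : t ∈ T.triangles)
    (hne : t ≠ tri w p q) (hne' : t ≠ tri (w + (p + q)) (-p) (-q)) :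
    hull (tri w p (p + q)) ∩ hull t = hull (tri w p (p + q) ∩ t) := by
  refine (Set.Subset.antisymm (hull_inter_subset _ _) ?_).symm
  rintro x ⟨hx, hxt⟩
  have hside : side w (p + q) x ≤ 0 := side_add w p q x ▸ ((mem_hull_tri_right h).1 hx).1
  obtain ⟨s, hs, hxs⟩ : ∃ s, (s = tri w p q ∨ s = tri (w + (p + q)) (-p) (-q)) ∧
      x ∈ hull (s ∩ t) := by
    rcases (hull_tri_union_hull_tri_opposite h).ge (.inl hx) with hx | hx
    · exact ⟨_, .inl rfl, T.inter_eq _ hlower _ ht ▸ ⟨hx, hxt⟩⟩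
    · exact ⟨_, .inr rfl, T.inter_eq _ hupper _ ht ▸ ⟨hx, hxt⟩⟩
  have hsub : s ⊆ para w p q := by
    rcases hs with rfl | rfl
    · exact tri_subset_para w p q
    · exact tri_opposite_subset_para w p q
  by_cases hq : w + q ∈ t
  · have hp : w + p ∉ t := fun hp =>
      (T.eq_or_eq_of_share_side h hlower hupper ht hp hq).elim hne hne'
    refine hull_mono (fun z hz => ?_) (mem_hull_filter_of_side_nonpos (fun z hz => ?_) hxs hside)
    · obtain ⟨hz, h0⟩ := Finset.mem_filter.1 hz
      obtain ⟨hz, hzt⟩ := Finset.mem_inter.1 hz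
      rcases mem_para.1 (hsub hz) with rfl | rfl | rfl | rfl
      · simp [tri, hzt]
      · exact absurd hzt hp
      · simp [tri, hzt]
      · simp [h] at h0
    · obtain ⟨hz, hzt⟩ := Finset.mem_inter.1 hz
      rcases mem_para.1 (hsub hz) with rfl | rfl | rfl | rfl
      · simp
      · exact absurd hzt hp
      · simp
      · simp [h]
  · refine hull_mono (fun z hz => ?_) hxs
    obtain ⟨hz, hzt⟩ := Finset.mem_inter.1 hz
    rcases mem_para.1 (hsub hz) with rfl | rfl | rfl | rfl
    · simp [tri, hzt]
    · simp [tri, hzt]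
    · simp [tri, hzt]
    · exact absurd hzt hq

theorem Triangulation.hull_tri_left_inter {t : Finset Pt} (ht : t ∈ T.triangles)
    (hne : t ≠ tri w p q) (hne' : t ≠ tri (w + (p + q)) (-p) (-q)) :
    hull (tri w (p + q) q) ∩ hull t = hull (tri w (p + q) q ∩ t) := by
  have hopp := tri_opposite_opposite w p q
  have := T.hull_tri_right_inter (w := w + (p + q)) (by simpa using h) hupper
    (by rwa [hopp]) ht hne' (by rwa [hopp])
  rwa [tri_opposite_left] at this

theorem Triangulation.hull_inter_hull_of_mem_flip {s t : Finset Pt}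
    (hs : s ∈ (T.triangles \ {tri w p q, tri (w + (p + q)) (-p) (-q)}) ∪
      {tri w p (p + q), tri w (p + q) q})
    (ht : t ∈ (T.triangles \ {tri w p q, tri (w + (p + q)) (-p) (-q)}) ∪
      {tri w p (p + q), tri w (p + q) q}) : hull s ∩ hull t = hull (s ∩ t) := by
  have hright {t : Finset Pt} (ht : t ∈ T.triangles \
      {tri w p q, tri (w + (p + q)) (-p) (-q)}) :=
    T.hull_tri_right_inter h hlower hupper ht.1 (fun he => ht.2 (.inl he))
      (fun he => ht.2 (.inr he))
  have hleft {t : Finset Pt} (ht : t ∈ T.triangles \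
      {tri w p q, tri (w + (p + q)) (-p) (-q)}) :=
    T.hull_tri_left_inter h hlower hupper ht.1 (fun he => ht.2 (.inl he))
      (fun he => ht.2 (.inr he))
  have hnew := hull_tri_right_inter_hull_tri_left (w := w) h
  rcases hs with hs | rfl | rfl <;> rcases ht with ht | rfl | rfl
  · exact T.inter_eq s hs.1 t ht.1
  · rw [Set.inter_comm, Finset.inter_comm, hright hs]
  · rw [Set.inter_comm, Finset.inter_comm, hleft hs]
  · exact hright ht
  · rw [Set.inter_self, Finset.inter_self]
  · exact hnew
  · exact hleft ht
  · rw [Set.inter_comm, Finset.inter_comm, hnew]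
  · rw [Set.inter_self, Finset.inter_self]

/-- The triangulation that arises by a flip on the parallelogram spanned by `p` and `q` at `w`. -/
def Triangulation.flip : Triangulation Ω where
  triangles := (T.triangles \ {tri w p q, tri (w + (p + q)) (-p) (-q)}) ∪
    {tri w p (p + q), tri w (p + q) q}
  card_eq_three := by
    rintro t (⟨ht, -⟩ | rfl | rfl)
    · exact T.card_eq_three t ht
    · exact card_tri (by simp [h])
    · exact card_tri (by simp [h])
  affineIndependent := by
    rintro t (⟨ht, -⟩ | rfl | rfl)
    · exact T.affineIndependent t ht
    · exact affineIndependent_tri (by simp [h])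
    · exact affineIndependent_tri (by simp [h])
  inter_eq _ hs _ ht := T.hull_inter_hull_of_mem_flip h hlower hupper hs ht
  cover := by
    have hsub : {tri w p q, tri (w + (p + q)) (-p) (-q)} ⊆ T.triangles :=
      Set.pair_subset hlower hupper
    rw [Set.biUnion_union, Set.biUnion_pair, ← hull_tri_union_hull_tri_opposite h,
      ← Set.biUnion_pair, ← Set.biUnion_union, Set.sdiff_union_of_subset hsub, T.cover]
  full := by
    intro z hz
    obtain ⟨t, ht, hzt⟩ := T.full z hz
    by_cases hold : t = tri w p q ∨ t = tri (w + (p + q)) (-p) (-q)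
    · have hmem : z ∈ para w p q := by
        rcases hold with rfl | rfl
        · exact tri_subset_para w p q hzt
        · exact tri_opposite_subset_para w p q hzt
      rcases mem_para.1 hmem with rfl | rfl | rfl | rfl
      · exact ⟨_, .inr (.inl rfl), by simp [tri]⟩
      · exact ⟨_, .inr (.inl rfl), by simp [tri]⟩
      · exact ⟨_, .inr (.inl rfl), by simp [tri]⟩
      · exact ⟨_, .inr (.inr rfl), by simp [tri]⟩
    · exact ⟨t, .inl ⟨ht, hold⟩, hzt⟩

end Flip

/-- `T'` arises from `T` by a flip on the parallelogram spanned by the anticlockwise basis `(p, q)`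
at `w`, which replaces the diagonal from `w + p` to `w + q` by the one from `w` to `w + (p + q)`. -/
structure IsFlipAt (T T' : Triangulation Ω) (w p q : Pt) : Prop where
  cross_eq : cross p q = 1
  lower_mem : tri w p q ∈ T.triangles
  upper_mem : tri (w + (p + q)) (-p) (-q) ∈ T.triangles
  triangles_eq : T'.triangles = (T.triangles \ {tri w p q, tri (w + (p + q)) (-p) (-q)}) ∪
    {tri w p (p + q), tri w (p + q) q}

theorem Triangulation.exists_isFlipAt (T : Triangulation Ω) {w p q : Pt} (h : cross p q = 1)
    (hlower : tri w p q ∈ T.triangles) (hupper : tri (w + (p + q)) (-p) (-q) ∈ T.triangles) :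
    ∃ T', IsFlipAt T T' w p q :=
  ⟨T.flip h hlower hupper, h, hlower, hupper, rfl⟩

namespace IsFlipAt

variable {T T' : Triangulation Ω} {w p q : Pt}

theorem rotate (h : IsFlipAt T T' w p q) : IsFlipAt T T' (w + (p + q)) (-p) (-q) where
  cross_eq := by simpa using h.cross_eq
  lower_mem := h.upper_mem
  upper_mem := by rw [tri_opposite_opposite]; exact h.lower_mem
  triangles_eq := by
    rw [tri_opposite_opposite, tri_opposite_left, tri_opposite_right, h.triangles_eq,
      Set.pair_comm (tri w p q), Set.pair_comm (tri w p (p + q))]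

theorem isFlip (h : IsFlipAt T T' w p q) : IsFlip T (para w p q) T' := by
  refine ⟨w + p, w + (p + q), w + q, w, (insert_eq_para w p q).symm,
    ⟨(1 / 2 : ℝ) • toPlane (w + p) + (1 / 2 : ℝ) • toPlane (w + q),
      ⟨1 / 2, 1 / 2, by norm_num, by norm_num, by norm_num, rfl⟩,
      ⟨1 / 2, 1 / 2, by norm_num, by norm_num, by norm_num, ?_⟩⟩,
    insert_eq_tri_opposite w p q ▸ h.upper_mem, insert_eq_tri w p q ▸ h.lower_mem, ?_⟩
  · ext <;> simp [toPlane] <;> ring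
  · rw [h.triangles_eq, insert_eq_tri_opposite, insert_eq_tri, insert_eq_tri, insert_eq_tri,
      Set.pair_comm (tri w p q)]

end IsFlipAt

/-! ### Flips of unimodular triangulations -/

/-- Every triangle is spanned by a basis of the lattice, that is, has the least possible area. -/
def Triangulation.IsUnimodular (T : Triangulation Ω) : Prop :=
  ∀ t ∈ T.triangles, ∃ w p q, cross p q = 1 ∧ t = tri w p q

theorem tri_comm (w p q : Pt) : tri w p q = tri w q p := by
  rw [tri, Finset.pair_comm, tri]

theorem cross_sub_sub_of_mem_tri {w p q a b c : Pt} (h : cross p q = 1) (ha : a ∈ tri w p q)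
    (hb : b ∈ tri w p q) (hc : c ∈ tri w p q) (hab : a ≠ b) (hac : a ≠ c) (hbc : b ≠ c) :
    cross (b - a) (c - a) = 1 ∨ cross (b - a) (c - a) = -1 := by
  have hqp : cross q p = -1 := by rw [cross_swap, h]
  rcases mem_tri.1 ha with rfl | rfl | rfl <;> rcases mem_tri.1 hb with rfl | rfl | rfl <;>
    rcases mem_tri.1 hc with rfl | rfl | rfl <;>
    first
    | contradiction
    | simp [cross_sub_left, cross_sub_right, h, hqp]

theorem Triangulation.IsUnimodular.cross_sub_sub {T : Triangulation Ω} (hT : T.IsUnimodular)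
    {a b c : Pt} (h : {a, b, c} ∈ T.triangles) :
    cross (b - a) (c - a) = 1 ∨ cross (b - a) (c - a) = -1 := by
  obtain ⟨w, p, q, hpq, ht⟩ := hT _ h
  have hcard := T.card_eq_three _ h
  obtain ⟨ha, hb, hc⟩ : a ∈ tri w p q ∧ b ∈ tri w p q ∧ c ∈ tri w p q := by simp [← ht]
  refine cross_sub_sub_of_mem_tri hpq ha hb hc ?_ ?_ ?_ <;> rintro rfl
  · rw [Finset.insert_idem] at hcard
    exact absurd hcard (Finset.card_le_two.trans_lt (by norm_num)).ne
  · rw [Finset.pair_comm, Finset.insert_idem] at hcard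
    exact absurd hcard (Finset.card_le_two.trans_lt (by norm_num)).ne
  · rw [Finset.pair_eq_singleton] at hcard
    exact absurd hcard (Finset.card_le_two.trans_lt (by norm_num)).ne

/-- As both triangles on the diagonal `ac` have the least area, the diagonals bisect each other:
`bd` is bisected because the areas agree, and `ac` because the area of `abd`, which is an integer,
lies strictly between zero and two. -/
theorem add_eq_add_of_openSegment_inter {a b c d : Pt}
    (hx : (openSegment ℝ (toPlane a) (toPlane c) ∩
      openSegment ℝ (toPlane b) (toPlane d)).Nonempty)
    (h1 : cross (b - a) (c - a) = 1 ∨ cross (b - a) (c - a) = -1)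
    (h2 : cross (c - a) (d - a) = 1 ∨ cross (c - a) (d - a) = -1) : a + c = b + d := by
  obtain ⟨x, ⟨s', s, hs', hs, hss, rfl⟩, r', r, -, -, hrr, he⟩ := hx
  have hac : r' * -cross (b - a) (c - a) + r * cross (c - a) (d - a) = (0 : ℝ) := by
    have := congrArg (side a (c - a)) he
    rw [side_combo _ _ _ _ hrr, side_combo _ _ _ _ hss] at this
    simpa [cross_swap (b - a) (c - a)] using this
  have hab : r * cross (b - a) (d - a) = s * cross (b - a) (c - a) := by
    have := congrArg (side a (b - a)) he
    rw [side_combo _ _ _ _ hrr, side_combo _ _ _ _ hss] at this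
    simpa using this
  obtain rfl : r = 1 / 2 := by
    rcases h1 with h1 | h1 <;> rcases h2 with h2 | h2 <;> rw [h1, h2] at hac <;>
      push_cast at hac <;> linarith
  have hdab : cross (b - a) (d - a) = cross (b - a) (c - a) := by
    rcases h1 with h1 | h1 <;> rw [h1] at hab ⊢ <;> push_cast at hab
    · have hpos : (0 : ℝ) < cross (b - a) (d - a) := by linarith
      have hlt : (cross (b - a) (d - a) : ℝ) < 2 := by linarith
      norm_cast at hpos hlt
      omega
    · have hneg : (cross (b - a) (d - a) : ℝ) < 0 := by linarith
      have hgt : (-2 : ℝ) < cross (b - a) (d - a) := by linarith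
      norm_cast at hneg hgt
      omega
  obtain rfl : s = 1 / 2 := by
    rw [hdab] at hab
    refine (mul_right_cancel₀ ?_ hab).symm
    rcases h1 with h1 | h1 <;> simp [h1]
  obtain rfl : r' = 1 / 2 := by linarith
  obtain rfl : s' = 1 / 2 := by linarith
  have e1 := congrArg Prod.fst he
  have e2 := congrArg Prod.snd he
  simp only [toPlane, Prod.fst_add, Prod.snd_add, Prod.smul_fst, Prod.smul_snd, smul_eq_mul]
    at e1 e2
  ext
  · exact_mod_cast (by linarith : (a.1 + c.1 : ℝ) = b.1 + d.1)
  · exact_mod_cast (by linarith : (a.2 + c.2 : ℝ) = b.2 + d.2)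

theorem IsFlip.exists_isFlipAt {T T' : Triangulation Ω} {Q : Quad} (h : IsFlip T Q T')
    (hT : T.IsUnimodular) : ∃ w p q, Q = para w p q ∧ IsFlipAt T T' w p q := by
  obtain ⟨a, b, c, d, rfl, hx, habc, hacd, hT'⟩ := h
  have hcross := hT.cross_sub_sub hacd
  have hb := add_eq_add_of_openSegment_inter hx (hT.cross_sub_sub habc) hcross
  obtain ⟨p, rfl⟩ : ∃ p, a = d + p := ⟨a - d, by abel⟩
  obtain ⟨q, rfl⟩ : ∃ q, c = d + q := ⟨c - d, by abel⟩
  obtain rfl : b = d + (p + q) := by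
    rw [eq_sub_of_add_eq hb.symm]; abel
  rw [insert_eq_tri_opposite, insert_eq_tri, insert_eq_tri, insert_eq_tri,
    Set.pair_comm (tri _ _ _) (tri d p q)] at hT'
  rw [insert_eq_tri_opposite] at habc
  rw [insert_eq_tri] at hacd
  rw [insert_eq_para]
  have hpq : cross (d + q - (d + p)) (d - (d + p)) = cross p q := by
    rw [show d + q - (d + p) = q + -p by abel, show d - (d + p) = -p by abel]
    simp [cross_swap p q]
  rw [hpq] at hcross
  rcases hcross with hcross | hcross
  · exact ⟨d, p, q, rfl, hcross, hacd, habc, hT'⟩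
  · refine ⟨d, q, p, para_comm d p q, by rw [cross_swap, hcross, neg_neg], ?_, ?_, ?_⟩
    · rwa [tri_comm]
    · rwa [add_comm q p, tri_comm]
    · rw [hT', add_comm q p, tri_comm d q p, tri_comm _ (-q), tri_comm d q, tri_comm d (p + q) p,
        Set.pair_comm (tri d (p + q) q)]

theorem IsFlip.mem_of_hasEdge {T T' : Triangulation Ω} {Q : Quad} (h : IsFlip T Q T') {x y : Pt}
    (h' : T'.HasEdge x y) (hxy : ¬ T.HasEdge x y) : x ∈ Q ∧ y ∈ Q := by
  obtain ⟨a, b, c, d, rfl, -, -, -, hT'⟩ := h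
  obtain ⟨hne, t, ht, hx, hy⟩ := h'
  have hsub {s : Finset Pt} (hs : s ⊆ {a, b, c, d}) (hxs : x ∈ s) (hys : y ∈ s) :
      x ∈ ({a, b, c, d} : Finset Pt) ∧ y ∈ ({a, b, c, d} : Finset Pt) := ⟨hs hxs, hs hys⟩
  rw [hT'] at ht
  rcases ht with ⟨ht, -⟩ | rfl | rfl
  · exact absurd ⟨hne, t, ht, hx, hy⟩ hxy
  · exact hsub (by simp [Finset.insert_subset_iff]) hx hy
  · exact hsub (by simp) hx hy

namespace IsFlipAt

variable {T T' : Triangulation Ω} {w p q : Pt}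

theorem isUnimodular (h : IsFlipAt T T' w p q) (hT : T.IsUnimodular) : T'.IsUnimodular := by
  intro t ht
  rw [h.triangles_eq] at ht
  rcases ht with ⟨ht, -⟩ | rfl | rfl
  · exact hT t ht
  · exact ⟨w, p, p + q, by simp [h.cross_eq], rfl⟩
  · exact ⟨w, p + q, q, by simp [h.cross_eq], rfl⟩

theorem hasEdge_left (h : IsFlipAt T T' w p q) : T.HasEdge w (w + p) :=
  ⟨(ne_of_cross_ne_zero (h.cross_eq.trans_ne one_ne_zero)).1, _, h.lower_mem, by simp [tri],
    by simp [tri]⟩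

theorem hasEdge_right (h : IsFlipAt T T' w p q) : T.HasEdge w (w + q) :=
  ⟨(ne_of_cross_ne_zero (h.cross_eq.trans_ne one_ne_zero)).2.1, _, h.lower_mem, by simp [tri],
    by simp [tri]⟩

theorem hasEdge_opposite_left (h : IsFlipAt T T' w p q) : T.HasEdge (w + q) (w + q + p) :=
  ⟨(ne_of_cross_ne_zero (h.cross_eq.trans_ne one_ne_zero)).1, _, h.upper_mem,
    mem_tri_opposite.2 (by simp), mem_tri_opposite.2 (by simp [add_assoc, add_comm p])⟩

theorem hasEdge_opposite_right (h : IsFlipAt T T' w p q) : T.HasEdge (w + p) (w + p + q) :=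
  ⟨(ne_of_cross_ne_zero (h.cross_eq.trans_ne one_ne_zero)).2.1, _, h.upper_mem,
    mem_tri_opposite.2 (by simp), mem_tri_opposite.2 (by simp [add_assoc])⟩

/-- The other pairs of vertices of the parallelogram are edges of the triangles that the flip
removes. -/
theorem eq_or_eq_of_not_hasEdge (h : IsFlipAt T T' w p q) {x y : Pt} (hx : x ∈ para w p q)
    (hy : y ∈ para w p q) (hne : x ≠ y) (hxy : ¬ T.HasEdge x y) :
    (x = w ∧ y = w + (p + q)) ∨ (x = w + (p + q) ∧ y = w) := by
  have hlower : ¬ (x ∈ tri w p q ∧ y ∈ tri w p q) := fun hm =>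
    hxy ⟨hne, _, h.lower_mem, hm.1, hm.2⟩
  have hupper : ¬ (x ∈ tri (w + (p + q)) (-p) (-q) ∧ y ∈ tri (w + (p + q)) (-p) (-q)) := fun hm =>
    hxy ⟨hne, _, h.upper_mem, hm.1, hm.2⟩
  rw [mem_tri, mem_tri] at hlower
  rw [mem_tri_opposite, mem_tri_opposite] at hupper
  rw [mem_para] at hx hy
  tauto

end IsFlipAt

theorem IsFlip.exists_isFlipAt_of_not_hasEdge {T T' : Triangulation Ω} {Q : Quad}
    (h : IsFlip T Q T') (hT : T.IsUnimodular) {x y : Pt} (hx : x ∈ Q) (hy : y ∈ Q) (hne : x ≠ y)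
    (hxy : ¬ T.HasEdge x y) : ∃ p q, Q = para x p q ∧ IsFlipAt T T' x p q ∧ y = x + (p + q) := by
  obtain ⟨w, p, q, rfl, hw⟩ := h.exists_isFlipAt hT
  rcases hw.eq_or_eq_of_not_hasEdge hx hy hne hxy with ⟨rfl, rfl⟩ | ⟨rfl, rfl⟩
  · exact ⟨p, q, rfl, hw, rfl⟩
  · refine ⟨-p, -q, ?_, hw.rotate, by abel⟩
    ext z
    simp only [mem_para, add_assoc, add_neg_cancel_comm_assoc, ← neg_add, add_neg_cancel,
      add_zero]
    tauto

theorem IsFlip.isFlipAt {T T' : Triangulation Ω} {w p q : Pt} (h : IsFlip T (para w p q) T')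
    (hT : T.IsUnimodular) (hpq : cross p q = 1) (hne : ¬ T.HasEdge w (w + (p + q))) :
    IsFlipAt T T' w p q := by
  have hp : p ≠ 0 := by rintro rfl; simp [cross] at hpq
  have hq : q ≠ 0 := by rintro rfl; simp at hpq
  have hsum : p + q ≠ 0 := fun h0 => by
    have : cross p (p + q) = 1 := by simpa using hpq
    simp [h0] at this
  obtain ⟨p', q', hQ, hw, hsum'⟩ := h.exists_isFlipAt_of_not_hasEdge hT (mem_para.2 (by simp))
    (mem_para.2 (by simp)) (by simpa [eq_comm] using hsum) hne
  have hmem : w + p ∈ para w p' q' := hQ ▸ mem_para.2 (by simp)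
  rw [add_right_inj] at hsum'
  simp only [mem_para, add_right_inj, ← hsum', add_eq_left, hp, hq, left_eq_add, false_or] at hmem
  rcases hmem with rfl | rfl
  · rwa [add_left_cancel hsum']
  · obtain rfl : q = p' := by rw [add_comm p'] at hsum'; exact add_left_cancel hsum'
    rw [cross_swap, hw.cross_eq] at hpq
    norm_num at hpq

/-! ### Equilateral triangulations -/

/-- The rotation by sixty degrees, anticlockwise. -/
def rot (p : Pt) : Pt := (-p.2, p.1 + p.2)

theorem rot_neg (p : Pt) : rot (-p) = -rot p := by
  ext
  · simp [rot]
  · simp [rot, add_comm]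

theorem rot_sub (p q : Pt) : rot (p - q) = rot p - rot q := by
  ext <;> simp only [rot, Prod.fst_sub, Prod.snd_sub] <;> ring

theorem rot_rot (p : Pt) : rot (rot p) = rot p - p := by
  ext
  · simp [rot, sub_eq_add_neg]
  · simp [rot]

theorem cross_rot (p : Pt) : cross p (rot p) = lenSq p := by
  simp only [cross, rot, lenSq]; ring

theorem lenSq_neg (p : Pt) : lenSq (-p) = lenSq p := by
  simp only [lenSq, Prod.fst_neg, Prod.snd_neg]; ring

theorem lenSq_rot (p : Pt) : lenSq (rot p) = lenSq p := by
  simp only [lenSq, rot]; ring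

theorem lenSq_pos {p : Pt} (hp : p ≠ 0) : 0 < lenSq p := by
  have hsq : 4 * lenSq p = (2 * p.1 + p.2) ^ 2 + 3 * p.2 ^ 2 := by simp only [lenSq]; ring
  rcases eq_or_ne p.2 0 with h2 | h2
  · have : 0 < p.1 ^ 2 := sq_pos_of_ne_zero (fun h1 => hp (Prod.ext h1 h2))
    rw [h2] at hsq
    linarith
  · have : 0 < p.2 ^ 2 := by positivity
    linarith [sq_nonneg (2 * p.1 + p.2)]

theorem lenSq_eq_one_iff {p : Pt} :
    lenSq p = 1 ↔
      p ∈ ({(1, 0), (0, 1), (-1, 1), (-1, 0), (0, -1), (1, -1)} : Finset Pt) := by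
  constructor
  · obtain ⟨m, n⟩ := p
    intro h
    simp only [lenSq] at h
    have hm₁ : -1 ≤ m := by nlinarith [sq_nonneg (m + 2 * n)]
    have hm₂ : m ≤ 1 := by nlinarith [sq_nonneg (m + 2 * n)]
    have hn₁ : -1 ≤ n := by nlinarith [sq_nonneg (2 * m + n)]
    have hn₂ : n ≤ 1 := by nlinarith [sq_nonneg (2 * m + n)]
    interval_cases m <;> interval_cases n <;> simp_all
  · revert p
    decide

/-- Rotating `U` successively by sixty degrees produces all unit vectors. -/
theorem eq_of_lenSq_eq_one {U p : Pt} (hU : lenSq U = 1) (hp : lenSq p = 1) :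
    p = U ∨ p = rot U ∨ p = rot U - U ∨ p = -U ∨ p = -rot U ∨ p = U - rot U := by
  rw [lenSq_eq_one_iff] at hU hp
  revert p
  revert U
  decide

theorem tri_rotate (w p q : Pt) : tri (w + p) (q - p) (-p) = tri w p q := by
  ext z
  rw [mem_tri, mem_tri, show w + p + (q - p) = w + q by abel, show w + p + -p = w by abel]
  tauto

theorem exists_tri_rot_eq {U p : Pt} (hU : lenSq U = 1) (hp : lenSq p = 1) (a : Pt) :
    ∃ z, tri a p (rot p) = tri z U (rot U) ∨
      tri a p (rot p) = tri (z + (U + rot U)) (-U) (-rot U) := by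
  rcases eq_of_lenSq_eq_one hU hp with rfl | rfl | rfl | rfl | rfl | rfl
  · exact ⟨a, .inl rfl⟩
  · refine ⟨a - U, .inr ?_⟩
    rw [rot_rot, ← tri_rotate a]
    congr 1 <;> abel
  · refine ⟨a - U, .inl ?_⟩
    rw [rot_sub, rot_rot, ← tri_rotate a, ← tri_rotate (a + _)]
    congr 1 <;> abel
  · refine ⟨a - (U + rot U), .inr ?_⟩
    rw [rot_neg, sub_add_cancel]
  · refine ⟨a - rot U, .inl ?_⟩
    rw [rot_neg, rot_rot, ← tri_rotate a]
    congr 1 <;> abel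
  · refine ⟨a - rot U, .inr ?_⟩
    rw [rot_sub, rot_rot, ← tri_rotate a, ← tri_rotate (a + _)]
    congr 1 <;> abel

theorem exists_sector (p : Pt) :
    ∃ (u : Pt) (x y : ℤ), lenSq u = 1 ∧ 0 ≤ x ∧ 0 ≤ y ∧ p = x • u + y • rot u := by
  obtain ⟨m, n⟩ := p
  rcases le_total 0 m with hm | hm <;> rcases le_total 0 n with hn | hn <;>
    rcases le_total 0 (m + n) with hs | hs
  · exact ⟨(1, 0), m, n, by simp [lenSq], hm, hn, by simp [rot]⟩
  · exact ⟨(1, 0), m, n, by simp [lenSq], hm, hn, by simp [rot]⟩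
  · exact ⟨(1, -1), -n, m + n, by simp [lenSq], by omega, hs, by simp [rot]⟩
  · exact ⟨(0, -1), -m - n, m, by simp [lenSq], by omega, hm, by simp [rot]⟩
  · exact ⟨(0, 1), m + n, -m, by simp [lenSq], hs, by omega, by simp [rot]⟩
  · exact ⟨(-1, 1), n, -m - n, by simp [lenSq], hn, by omega, by simp [rot]⟩
  · exact ⟨(-1, 0), -m, -n, by simp [lenSq], by omega, by omega, by simp [rot]⟩
  · exact ⟨(-1, 0), -m, -n, by simp [lenSq], by omega, by omega, by simp [rot]⟩

theorem toPlane_mem_hull_tri {w p q z : Pt} {N x y : ℤ} (hN : 0 < N) (hx : 0 ≤ x) (hy : 0 ≤ y)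
    (hxy : x + y ≤ N) (h : N • z = x • p + y • q) : toPlane (w + z) ∈ hull (tri w p q) := by
  have hN' : (0 : ℝ) < N := by exact_mod_cast hN
  have hxy' : (x + y : ℝ) / N ≤ 1 := (div_le_one hN').2 (by exact_mod_cast hxy)
  have h1 : (N * z.1 : ℝ) = x * p.1 + y * q.1 := by exact_mod_cast congrArg Prod.fst h
  have h2 : (N * z.2 : ℝ) = x * p.2 + y * q.2 := by exact_mod_cast congrArg Prod.snd h
  have hz : toPlane (w + z) = (1 - (x + y : ℝ) / N) • toPlane w + (x / N : ℝ) • toPlane (w + p) +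
      (y / N : ℝ) • toPlane (w + q) := by
    ext
    · simp only [toPlane, Prod.fst_add, Prod.smul_fst, smul_eq_mul, Int.cast_add]
      field_simp
      linear_combination h1
    · simp only [toPlane, Prod.snd_add, Prod.fst_add, Prod.smul_snd, smul_eq_mul, Int.cast_add]
      field_simp
      linear_combination h2
  rw [hz]
  exact combo_mem_hull_tri (sub_nonneg.2 hxy') (div_nonneg (by exact_mod_cast hx) hN'.le)
    (div_nonneg (by exact_mod_cast hy) hN'.le) (by ring)

/-- Otherwise the triangle contains a lattice point next to `a` that is not one of its vertices. -/
theorem Triangulation.lenSq_eq_one_of_tri_rot_mem (T : Triangulation Ω) {a p : Pt}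
    (hp : 0 < lenSq p) (ht : tri a p (rot p) ∈ T.triangles) : lenSq p = 1 := by
  obtain ⟨u, x, y, hu, hx, hy, hxy⟩ := exists_sector p
  have hN : lenSq p = x ^ 2 + x * y + y ^ 2 := by
    rw [← mul_one (x ^ 2 + x * y + y ^ 2), ← hu, hxy]
    simp only [lenSq, rot, Prod.fst_add, Prod.snd_add, Prod.smul_fst, Prod.smul_snd, smul_eq_mul]
    ring
  have hmem : a + rot u ∈ tri a p (rot p) := by
    refine T.mem_of_toPlane_mem_hull ht (toPlane_mem_hull_tri hp hy hx ?_ ?_)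
    · nlinarith [mul_nonneg hx hy, Int.le_self_sq x, Int.le_self_sq y]
    · rw [hN, hxy]
      ext <;> simp only [rot, Prod.fst_add, Prod.snd_add, Prod.smul_fst, Prod.smul_snd,
        smul_eq_mul] <;> ring
  rw [← lenSq_rot] at hu
  rcases mem_tri.1 hmem with h | h | h
  · simp [add_eq_left.1 h, lenSq] at hu
  · exact add_left_cancel h ▸ hu
  · rw [← lenSq_rot, ← add_left_cancel h, hu]

theorem eq_rot_or_eq_rot {p r : Pt} (hr : lenSq r = lenSq p) (hpr : lenSq (r - p) = lenSq p) :
    r = rot p ∨ p = rot r := by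
  have hgram : cross p r = lenSq p ∨ cross p r = -lenSq p := by
    refine sq_eq_sq_iff_eq_or_eq_neg.1 (mul_left_cancel₀ (three_ne_zero (α := ℤ)) ?_)
    calc 3 * cross p r ^ 2 =
        4 * (lenSq p * lenSq r) - (lenSq p + lenSq r - lenSq (r - p)) ^ 2 := by
          simp only [lenSq, cross, Prod.fst_sub, Prod.snd_sub]; ring
      _ = 3 * lenSq p ^ 2 := by rw [hr, hpr]; ring
  have hleft : 2 * lenSq (r - rot p) = lenSq p + lenSq r + lenSq (r - p) - 3 * cross p r := by
    simp only [lenSq, cross, rot, Prod.fst_sub, Prod.snd_sub]; ring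
  have hright : 2 * lenSq (p - rot r) = lenSq p + lenSq r + lenSq (r - p) + 3 * cross p r := by
    simp only [lenSq, cross, rot, Prod.fst_sub, Prod.snd_sub]; ring
  refine hgram.imp (fun h => ?_) (fun h => ?_) <;> by_contra hne <;>
    have := lenSq_pos (sub_ne_zero.2 hne) <;> omega

/-- The sum of the coordinates of `p` with respect to a basis `U`, `W` with `cross U W = 1`. -/
def level (U W p : Pt) : ℤ := cross p W + cross U p

theorem level_add (U W p q : Pt) : level U W (p + q) = level U W p + level U W q := by
  simp only [level, cross_add_left, cross_add_right]; ring

theorem eq_of_cross_sub_eq_zero {U W w z : Pt} (h : cross U W = 1) (hU : cross U (z - w) = 0)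
    (hW : cross W (z - w) = 0) : z = w := by
  simp only [cross, Prod.fst_sub, Prod.snd_sub] at h hU hW
  ext
  · linear_combination (z.1 - w.1) * (-h) + W.1 * hU - U.1 * hW
  · linear_combination (z.2 - w.2) * (-h) + W.2 * hU - U.2 * hW

section UnitVector

variable {T : Triangulation Ω} (hT : T.IsEquilateral) {U : Pt} (hU : lenSq U = 1)
include hT hU

theorem Triangulation.IsEquilateral.exists_eq_tri {t : Finset Pt} (ht : t ∈ T.triangles) :
    ∃ z, t = tri z U (rot U) ∨ t = tri (z + (U + rot U)) (-U) (-rot U) := by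
  suffices ∃ a p, 0 < lenSq p ∧ t = tri a p (rot p) by
    obtain ⟨a, p, hp, rfl⟩ := this
    exact exists_tri_rot_eq hU (T.lenSq_eq_one_of_tri_rot_mem hp ht) a
  obtain ⟨a, b, c, hab, hac, hbc, rfl⟩ := Finset.card_eq_three.1 (T.card_eq_three t ht)
  have hedge {x y : Pt} (hx : x ∈ ({a, b, c} : Finset Pt)) (hy : y ∈ ({a, b, c} : Finset Pt))
      (hxy : x ≠ y) : lenSq (y - x) = lenSq (b - a) :=
    hT _ _ _ _ ⟨hxy, _, ht, hx, hy⟩ ⟨hab, _, ht, by simp, by simp⟩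
  have hca : lenSq (c - a) = lenSq (b - a) := hedge (by simp) (by simp) hac
  have hcb : lenSq (c - a - (b - a)) = lenSq (b - a) :=
    sub_sub_sub_cancel_right c b a ▸ hedge (by simp) (by simp) hbc
  rcases eq_rot_or_eq_rot hca hcb with h | h
  · refine ⟨a, b - a, lenSq_pos (sub_ne_zero.2 hab.symm), ?_⟩
    rw [← h, tri, add_sub_cancel, add_sub_cancel]
  · refine ⟨a, c - a, lenSq_pos (sub_ne_zero.2 hac.symm), ?_⟩
    rw [← h, tri, add_sub_cancel, add_sub_cancel, Finset.pair_comm]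

theorem Triangulation.IsEquilateral.level_le_one {a b : Pt} (h : T.HasEdge a b) :
    level U (rot U) (b - a) ≤ 1 := by
  have hUW : cross U (rot U) = 1 := by rw [cross_rot, hU]
  obtain ⟨-, t, ht, ha, hb⟩ := h
  obtain ⟨z, rfl | rfl⟩ := hT.exists_eq_tri hU ht
  · rcases mem_tri.1 ha with rfl | rfl | rfl <;> rcases mem_tri.1 hb with rfl | rfl | rfl <;>
      simp [level, cross_sub_left, cross_sub_right, hUW]
  · rcases mem_tri_opposite.1 ha with rfl | rfl | rfl <;>
      rcases mem_tri_opposite.1 hb with rfl | rfl | rfl <;>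
      simp [level, cross_sub_left, cross_sub_right, hUW]

theorem Triangulation.IsEquilateral.exists_mem_hull {x : Plane} (hx : x ∈ Ω) :
    ∃ z, (tri z U (rot U) ∈ T.triangles ∧ x ∈ hull (tri z U (rot U))) ∨
      (tri (z + (U + rot U)) (-U) (-rot U) ∈ T.triangles ∧
        x ∈ hull (tri (z + (U + rot U)) (-U) (-rot U))) := by
  rw [← T.cover] at hx
  obtain ⟨t, ht, hxt⟩ := Set.mem_iUnion₂.1 hx
  obtain ⟨z, rfl | rfl⟩ := hT.exists_eq_tri hU ht
  · exact ⟨z, .inl ⟨ht, hxt⟩⟩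
  · exact ⟨z, .inr ⟨ht, hxt⟩⟩

theorem Triangulation.IsEquilateral.lower_mem {x : Plane} (hx : x ∈ Ω) {w : Pt}
    (hW : side w (rot U) x < 0) (hU' : 0 < side w U x) (hUW : side w U x - side w (rot U) x < 1) :
    tri w U (rot U) ∈ T.triangles := by
  have hcross : cross U (rot U) = 1 := by rw [cross_rot, hU]
  obtain ⟨z, ⟨ht, h⟩ | ⟨-, h⟩⟩ := hT.exists_mem_hull hU hx
  · obtain ⟨h1, h2, h3⟩ := (mem_hull_tri hcross).1 h
    rw [side_eq_sub w z U] at h2 h3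
    rw [side_eq_sub w z (rot U)] at h1 h3
    have hA : cross U (z - w) < 1 := by exact_mod_cast (by linarith : (cross U (z - w) : ℝ) < 1)
    have hB : -1 < cross (rot U) (z - w) := by
      exact_mod_cast (by linarith : (-1 : ℝ) < cross (rot U) (z - w))
    have hAB : -1 < cross U (z - w) - cross (rot U) (z - w) := by
      exact_mod_cast (by linarith : (-1 : ℝ) < cross U (z - w) - cross (rot U) (z - w))
    rwa [← eq_of_cross_sub_eq_zero hcross (show cross U (z - w) = 0 by omega) (by omega)]
  · obtain ⟨h1, h2, h3⟩ := (mem_hull_tri_opposite hcross).1 h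
    rw [side_eq_sub w z U] at h2 h3
    rw [side_eq_sub w z (rot U)] at h1 h3
    have hA : -1 < cross U (z - w) := by
      exact_mod_cast (by linarith : (-1 : ℝ) < cross U (z - w))
    have hB : cross (rot U) (z - w) < 1 := by
      exact_mod_cast (by linarith : (cross (rot U) (z - w) : ℝ) < 1)
    have hAB : 0 < cross (rot U) (z - w) - cross U (z - w) := by
      exact_mod_cast (by linarith : (0 : ℝ) < cross (rot U) (z - w) - cross U (z - w))
    omega

theorem Triangulation.IsEquilateral.upper_mem {x : Plane} (hx : x ∈ Ω) {w : Pt}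
    (hW : -1 < side w (rot U) x) (hU' : side w U x < 1)
    (hUW : 1 < side w U x - side w (rot U) x) :
    tri (w + (U + rot U)) (-U) (-rot U) ∈ T.triangles := by
  have hcross : cross U (rot U) = 1 := by rw [cross_rot, hU]
  have hcross' : cross (rot U) U = -1 := by rw [cross_swap, hcross]
  have hneg := hT.lower_mem (U := -U) ((lenSq_neg U).trans hU) hx (w := w + (U + rot U))
  simp only [rot_neg, side_add_neg, cross_add_right, cross_self, hcross, hcross'] at hneg
  push_cast at hneg
  exact hneg (by linarith) (by linarith) (by linarith)

theorem Triangulation.IsEquilateral.hasEdge_of_midpoint_mem {v : Pt}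
    (hΩ : midpoint ℝ (toPlane v) (toPlane (v + U)) ∈ Ω) : T.HasEdge v (v + U) := by
  have hcross : cross U (rot U) = 1 := by rw [cross_rot, hU]
  have hcross' : cross (rot U) U = -1 := by rw [cross_swap, hcross]
  have hside (z p : Pt) : side z p (midpoint ℝ (toPlane v) (toPlane (v + U))) =
      cross p (v - z) + cross p U / 2 := by
    rw [midpoint_eq_smul_add, invOf_eq_inv, smul_add,
      side_combo _ _ _ _ (by norm_num), side_toPlane,
      side_toPlane, add_sub_right_comm, cross_add_right]
    push_cast
    ring
  refine ⟨(ne_of_cross_ne_zero (q := rot U) (by simp [hcross])).1, ?_⟩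
  obtain ⟨z, ⟨ht, h⟩ | ⟨ht, h⟩⟩ := hT.exists_mem_hull hU hΩ
  · rw [mem_hull_tri hcross, hside, hside, cross_self, hcross'] at h
    push_cast at h
    obtain ⟨h1, h2, h3⟩ := h
    have hA : 0 ≤ cross U (v - z) := by exact_mod_cast (by linarith : (0 : ℝ) ≤ cross U (v - z))
    have hB : cross (rot U) (v - z) < 1 := by
      exact_mod_cast (by linarith : (cross (rot U) (v - z) : ℝ) < 1)
    have hAB : cross U (v - z) - cross (rot U) (v - z) < 1 := by
      exact_mod_cast (by linarith : (cross U (v - z) - cross (rot U) (v - z) : ℝ) < 1)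
    obtain rfl := eq_of_cross_sub_eq_zero hcross (show cross U (v - z) = 0 by omega) (by omega)
    exact ⟨_, ht, mem_tri.2 (.inl rfl), mem_tri.2 (.inr (.inl rfl))⟩
  · rw [mem_hull_tri_opposite hcross, hside, hside, cross_self, hcross'] at h
    push_cast at h
    obtain ⟨h1, h2, h3⟩ := h
    have hA : cross U (v - z) ≤ 1 := by exact_mod_cast (by linarith : (cross U (v - z) : ℝ) ≤ 1)
    have hB : -1 < cross (rot U) (v - z) := by
      exact_mod_cast (by linarith : (-1 : ℝ) < cross (rot U) (v - z))
    have hAB : 0 < cross U (v - z) - cross (rot U) (v - z) := by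
      exact_mod_cast (by linarith : (0 : ℝ) < cross U (v - z) - cross (rot U) (v - z))
    obtain rfl : v = z + rot U := eq_of_cross_sub_eq_zero hcross
      (by rw [← sub_sub, cross_sub_right, hcross]; omega)
      (by rw [← sub_sub, cross_sub_right, cross_self]; omega)
    exact ⟨_, ht, mem_tri_opposite.2 (.inr (.inl rfl)),
      mem_tri_opposite.2 (.inl (by abel))⟩

end UnitVector

theorem Triangulation.IsEquilateral.isUnimodular {T : Triangulation Ω} (hT : T.IsEquilateral) :
    T.IsUnimodular := by
  intro t ht
  obtain ⟨U, hU⟩ : ∃ U, lenSq U = 1 := ⟨(1, 0), by simp [lenSq]⟩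
  have hcross : cross U (rot U) = 1 := by rw [cross_rot, hU]
  obtain ⟨z, h | h⟩ := hT.exists_eq_tri hU ht
  · exact ⟨_, _, _, hcross, h⟩
  · exact ⟨_, _, _, by simpa using hcross, h⟩

theorem coordPair_snd (i : Fin 3) : (coordPair i).2 = rot (coordPair i).1 := by
  fin_cases i <;> rfl

theorem lenSq_coordPair_fst (i : Fin 3) : lenSq (coordPair i).1 = 1 := by
  fin_cases i <;> rfl

theorem cross_coordPair (i : Fin 3) : cross (coordPair i).1 (coordPair i).2 = 1 := by
  rw [coordPair_snd, cross_rot, lenSq_coordPair_fst]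

theorem Triangulation.IsEquilateral.hasEdge_of_isUnit {T : Triangulation Ω}
    (hT : T.IsEquilateral) {e : Edge} (he : e.IsUnit) {v : Pt}
    (hΩ : segment ℝ (toPlane v) (toPlane (v + e.vec)) ⊆ Ω) : T.HasEdge v (v + e.vec) := by
  refine hT.hasEdge_of_midpoint_mem ?_ (hΩ (midpoint_mem_segment _ _))
  rcases he with ⟨hx, hy⟩ | ⟨hx, hy⟩
  · simp [Edge.vec, hx, hy, lenSq_coordPair_fst]
  · simp [Edge.vec, hx, hy, coordPair_snd, lenSq_rot, lenSq_coordPair_fst]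

/-! ### The parallelograms of the flip plan and their triangles -/

/-- The bases (as nodes of the tree of bases) and the base points of the parallelograms in the
flip plan `treeDag U W l v`. -/
def treeNodes (U W : Pt) : List Bool → Pt → Finset (List Bool × Pt)
  | [], v => {([], v)}
  | b :: l, v =>
    insert (b :: l, v) (treeNodes U W l v ∪ treeNodes U W l (v + treeShift U W b l))

/-- The triangle at `w` spanned by a basis of the tree. Together with `upperTri` it forms the
parallelogram `treeQuad`. -/
def lowerTri (U W : Pt) (l : List Bool) (w : Pt) : Finset Pt :=
  tri w (treeBasis U W l).1 (treeBasis U W l).2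

/-- The triangle that is opposite to `lowerTri` in the parallelogram `treeQuad`. -/
def upperTri (U W : Pt) (l : List Bool) (w : Pt) : Finset Pt :=
  tri (w + treeVec U W l) (-(treeBasis U W l).1) (-(treeBasis U W l).2)

/-- The triangles that the flip on `treeQuad U W l w` removes. -/
def removed (U W : Pt) (l : List Bool) (w : Pt) : Set (Finset Pt) :=
  {lowerTri U W l w, upperTri U W l w}

/-- The triangles that the flip on `treeQuad U W l w` adds. -/
def added (U W : Pt) (l : List Bool) (w : Pt) : Set (Finset Pt) :=
  {lowerTri U W (true :: l) w, lowerTri U W (false :: l) w}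

variable {U W : Pt}

theorem mem_treeNodes_cons {b : Bool} {l : List Bool} {v : Pt} {n : List Bool × Pt} :
    n ∈ treeNodes U W (b :: l) v ↔ n = (b :: l, v) ∨ n ∈ treeNodes U W l v ∨
      n ∈ treeNodes U W l (v + treeShift U W b l) := by
  simp [treeNodes]

theorem self_mem_treeNodes (l : List Bool) (v : Pt) : (l, v) ∈ treeNodes U W l v := by
  cases l <;> simp [treeNodes]

theorem treeNodes_induction {P : List Bool → Pt → Prop} {l m : List Bool} {v w : Pt} (root : P l v)
    (step : ∀ b k u, b :: k <:+ l → P (b :: k) u → P k u ∧ P k (u + treeShift U W b k))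
    (h : (m, w) ∈ treeNodes U W l v) : P m w := by
  induction l generalizing v with
  | nil => simp_all [treeNodes]
  | cons b l ih =>
    have hl := step b l v List.suffix_rfl root
    have step' b' k u (hk : b' :: k <:+ l) := step b' k u (hk.trans (List.suffix_cons b l))
    rcases mem_treeNodes_cons.1 h with h | h | h
    · obtain ⟨rfl, rfl⟩ := Prod.mk.inj h
      exact root
    · exact ih hl.1 step' h
    · exact ih hl.2 step' h

theorem suffix_of_mem_treeNodes {l m : List Bool} {v w : Pt} (h : (m, w) ∈ treeNodes U W l v) :
    m <:+ l :=
  treeNodes_induction (P := fun m _ => m <:+ l) List.suffix_rfl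
    (fun b k _ h _ => ⟨(List.suffix_cons b k).trans h, (List.suffix_cons b k).trans h⟩) h

theorem children_mem_treeNodes {l m : List Bool} {b : Bool} {v w : Pt}
    (h : (b :: m, w) ∈ treeNodes U W l v) :
    (m, w) ∈ treeNodes U W l v ∧ (m, w + treeShift U W b m) ∈ treeNodes U W l v := by
  induction l generalizing v with
  | nil => simp [treeNodes] at h
  | cons c l ih =>
    simp only [mem_treeNodes_cons] at h ⊢
    rcases h with h | h | h
    · obtain ⟨⟨rfl, rfl⟩, rfl⟩ : (b = c ∧ m = l) ∧ w = v := by simpa using h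
      exact ⟨.inr (.inl (self_mem_treeNodes _ _)), .inr (.inr (self_mem_treeNodes _ _))⟩
    · exact ⟨.inr (.inl (ih h).1), .inr (.inl (ih h).2)⟩
    · exact ⟨.inr (.inr (ih h).1), .inr (.inr (ih h).2)⟩

theorem treeNodes_subset_append (m l : List Bool) (v : Pt) :
    treeNodes U W l v ⊆ treeNodes U W (m ++ l) v := by
  induction m with
  | nil => exact Finset.Subset.refl _
  | cons b m ih => exact fun n hn => mem_treeNodes_cons.2 (.inr (.inl (ih hn)))

theorem mem_treeDag_flips {l : List Bool} {v : Pt} {Q : Quad} :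
    Q ∈ (treeDag U W l v).flips ↔ ∃ n ∈ treeNodes U W l v, Q = treeQuad U W n.1 n.2 := by
  induction l generalizing v with
  | nil => simp only [treeDag, treeNodes, Finset.mem_singleton, exists_eq_left]
  | cons b l ih =>
    simp only [treeDag, Finset.mem_union, Finset.mem_singleton, ih, mem_treeNodes_cons,
      or_and_right, exists_or, or_assoc, exists_eq_left]

theorem mem_treeDag_arcs {l : List Bool} {v : Pt} {P Q : Quad} :
    (P, Q) ∈ (treeDag U W l v).arcs ↔ ∃ b m w, (b :: m, w) ∈ treeNodes U W l v ∧
      Q = treeQuad U W (b :: m) w ∧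
      (P = treeQuad U W m w ∨ P = treeQuad U W m (w + treeShift U W b m)) := by
  induction l generalizing v with
  | nil => simp [treeDag, treeNodes]
  | cons b l ih =>
    simp only [treeDag, Finset.mem_union, Finset.mem_insert, Finset.mem_singleton, ih,
      mem_treeNodes_cons, Prod.mk.injEq, List.cons.injEq, or_and_right, exists_or, ← or_assoc,
      and_assoc, exists_eq_left, exists_and_left]
    rw [← or_and_right, and_comm]

theorem upperTri_cons (b : Bool) (l : List Bool) (w : Pt) :
    upperTri U W (b :: l) w = lowerTri U W ((!b) :: l) (w + treeShift U W b l) := by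
  ext z
  rw [upperTri, lowerTri, treeVec, mem_tri_opposite, mem_tri]
  cases b <;> simp only [treeBasis, treeShift, Bool.not_true, Bool.not_false, if_true,
    Bool.false_eq_true, if_false, add_left_comm, add_comm] <;> tauto

theorem mem_added_of_mem_removed_cons {b : Bool} {l : List Bool} {w : Pt} {t : Finset Pt}
    (h : t ∈ removed U W (b :: l) w) :
    t ∈ added U W l w ∨ t ∈ added U W l (w + treeShift U W b l) := by
  rw [removed, upperTri_cons] at h
  cases b
  · exact h.imp .inr .inl
  · exact h.imp .inl .inr

section Basis

variable (hUW : cross U W = 1)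
include hUW

theorem cross_treeBasis (l : List Bool) : cross (treeBasis U W l).1 (treeBasis U W l).2 = 1 := by
  induction l with
  | nil => exact hUW
  | cons b l ih => cases b <;> simpa [treeBasis] using ih

theorem cross_treeBasis_nonneg (l : List Bool) :
    0 ≤ cross U (treeBasis U W l).1 ∧ 0 < cross U (treeBasis U W l).2 ∧
      0 < cross (treeBasis U W l).1 W ∧ 0 ≤ cross (treeBasis U W l).2 W := by
  induction l with
  | nil => simp [treeBasis, hUW]
  | cons b l ih =>
    cases b <;> simp only [treeBasis, cross_add_left, cross_add_right] <;> omega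

theorem level_treeBasis_pos (l : List Bool) :
    0 < level U W (treeBasis U W l).1 ∧ 0 < level U W (treeBasis U W l).2 := by
  have := cross_treeBasis_nonneg hUW l
  unfold level
  omega

theorem treeBasis_injective : Function.Injective (treeBasis U W) := by
  have hlevel := level_treeBasis_pos hUW
  have hU : level U W U = 1 := by simp [level, hUW]
  have hW : level U W W = 1 := by simp [level, hUW]
  intro l m h
  induction l generalizing m with
  | nil =>
    rcases m with - | ⟨_ | _, m⟩
    · rfl
    all_goals
      obtain ⟨h₁, h₂⟩ := Prod.ext_iff.1 h
      have := hlevel m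
      have := congrArg (level U W) h₁
      have := congrArg (level U W) h₂
      simp only [treeBasis, level_add] at *
      omega
  | cons b l ih =>
    rcases m with - | ⟨c, m⟩
    · have := hlevel l
      have h₁ := congrArg (level U W) (Prod.ext_iff.1 h).1
      have h₂ := congrArg (level U W) (Prod.ext_iff.1 h).2
      cases b <;> simp only [treeBasis, level_add] at * <;> omega
    · obtain rfl : b = c := by
        have := hlevel l
        have := hlevel m
        have h₁ := congrArg (level U W) (Prod.ext_iff.1 h).1
        have h₂ := congrArg (level U W) (Prod.ext_iff.1 h).2
        cases b <;> cases c <;> simp only [treeBasis, level_add] at * <;> omega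
      suffices h : treeBasis U W l = treeBasis U W m by rw [ih h]
      have h₁ := (Prod.ext_iff.1 h).1
      have h₂ := (Prod.ext_iff.1 h).2
      cases b <;> simp only [treeBasis] at h₁ h₂
      · exact Prod.ext (by simpa [h₂] using h₁) h₂
      · exact Prod.ext h₁ (by simpa [h₁] using h₂)

end Basis

theorem eq_or_level_lt_of_mem_tri {w p q z : Pt} (hp : 0 < level U W p) (hq : 0 < level U W q)
    (hz : z ∈ tri w p q) : z = w ∨ level U W w < level U W z := by
  rcases mem_tri.1 hz with h | h | h
  · exact .inl h
  · exact .inr (by rw [h, level_add]; omega)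
  · exact .inr (by rw [h, level_add]; omega)

theorem eq_of_tri_eq {w p q w' p' q' : Pt} (hp : 0 < level U W p) (hq : 0 < level U W q)
    (hp' : 0 < level U W p') (hq' : 0 < level U W q') (hpq : cross p q = 1)
    (hpq' : cross p' q' = 1) (h : tri w p q = tri w' p' q') : w = w' ∧ p = p' ∧ q = q' := by
  obtain rfl : w = w' := by
    rcases eq_or_level_lt_of_mem_tri hp' hq' (h.subset (mem_tri.2 (.inl rfl))) with h₁ | h₁
    · exact h₁
    rcases eq_or_level_lt_of_mem_tri hp hq (h.symm.subset (mem_tri.2 (.inl rfl))) with h₂ | h₂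
    · exact h₂.symm
    · omega
  have hne {r : Pt} (hr : 0 < level U W r) : r ≠ 0 := by
    rintro rfl
    simp [level] at hr
  have hmem {r : Pt} (hr : 0 < level U W r) (h : w + r ∈ tri w p' q') : r = p' ∨ r = q' := by
    simpa [hne hr] using mem_tri.1 h
  have hpmem : p = p' ∨ p = q' := hmem hp (h.subset (mem_tri.2 (.inr (.inl rfl))))
  have hqmem : q = p' ∨ q = q' := hmem hq (h.subset (mem_tri.2 (.inr (.inr rfl))))
  rcases hpmem with rfl | rfl <;> rcases hqmem with rfl | rfl
  · simp at hpq
  · exact ⟨rfl, rfl, rfl⟩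
  · rw [cross_swap] at hpq
    omega
  · simp at hpq

section Basis

variable (hUW : cross U W = 1)
include hUW

theorem eq_of_lowerTri_eq {l m : List Bool} {w u : Pt} (h : lowerTri U W l w = lowerTri U W m u) :
    l = m ∧ w = u := by
  obtain ⟨hwu, h₁, h₂⟩ := eq_of_tri_eq (level_treeBasis_pos hUW l).1 (level_treeBasis_pos hUW l).2
    (level_treeBasis_pos hUW m).1 (level_treeBasis_pos hUW m).2 (cross_treeBasis hUW l)
    (cross_treeBasis hUW m) h
  exact ⟨treeBasis_injective hUW (Prod.ext h₁ h₂), hwu⟩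

theorem eq_of_upperTri_eq {l m : List Bool} {w u : Pt} (h : upperTri U W l w = upperTri U W m u) :
    l = m ∧ w = u := by
  have hlevel (p : Pt) : level (-U) (-W) (-p) = level U W p := by simp [level]
  have hl := level_treeBasis_pos hUW l
  have hm := level_treeBasis_pos hUW m
  simp only [← hlevel] at hl hm
  obtain ⟨hwu, h₁, h₂⟩ := eq_of_tri_eq hl.1 hl.2 hm.1 hm.2 (by simp [cross_treeBasis hUW])
    (by simp [cross_treeBasis hUW]) h
  obtain rfl := treeBasis_injective hUW (Prod.ext (neg_injective h₁) (neg_injective h₂))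
  exact ⟨rfl, add_right_cancel hwu⟩

theorem eq_of_lowerTri_eq_upperTri {l m : List Bool} {w u : Pt}
    (h : lowerTri U W l w = upperTri U W m u) : ∃ b k, m = b :: k ∧ l = (!b) :: k := by
  rcases m with - | ⟨b, k⟩
  · have hU : level U W U = 1 := by simp [level, hUW]
    have hW : level U W W = 1 := by simp [level, hUW]
    have hne : u + U ≠ u + W := fun heq => by
      simp [add_left_cancel heq] at hUW
    have hlt {z : Pt} (hz : z ∈ upperTri U W [] u) : z = w ∨ level U W w < level U W z :=
      eq_or_level_lt_of_mem_tri (level_treeBasis_pos hUW l).1 (level_treeBasis_pos hUW l).2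
        (h.symm.subset hz)
    have hw : w ∈ upperTri U W [] u := h.subset (mem_tri.2 (.inl rfl))
    simp only [upperTri, treeVec, treeBasis, mem_tri_opposite] at hlt hw
    have hle : level U W u + 1 ≤ level U W w := by
      rcases hw with rfl | rfl | rfl <;> simp only [level_add] <;> omega
    rcases hlt (.inr (.inl rfl)) with h₁ | h₁
    · rcases hlt (.inr (.inr rfl)) with h₂ | h₂
      · exact absurd (h₂.trans h₁.symm) hne
      · rw [level_add] at h₂
        omega
    · rw [level_add] at h₁
      omega
  · rw [upperTri_cons] at h
    exact ⟨b, k, rfl, (eq_of_lowerTri_eq hUW h).1⟩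

theorem eq_of_mem_removed {L l m : List Bool} {w u : Pt} {t : Finset Pt} (hl : l <:+ L)
    (hm : m <:+ L) (ht : t ∈ removed U W l w) (ht' : t ∈ removed U W m u) : l = m ∧ w = u := by
  have hne {b : Bool} {k : List Bool} (h₁ : b :: k <:+ L) (h₂ : (!b) :: k <:+ L) : False := by
    simpa using (List.suffix_of_suffix_length_le h₁ h₂ (by simp)).eq_of_length (by simp)
  rcases ht with rfl | rfl <;> rcases ht' with h | h
  · exact eq_of_lowerTri_eq hUW h
  · obtain ⟨b, k, rfl, rfl⟩ := eq_of_lowerTri_eq_upperTri hUW h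
    exact (hne hm hl).elim
  · obtain ⟨b, k, rfl, rfl⟩ := eq_of_lowerTri_eq_upperTri hUW h.symm
    exact (hne hl hm).elim
  · exact eq_of_upperTri_eq hUW h

theorem lowerTri_cons_notMem_removed {L l : List Bool} (hl : l <:+ L) (b : Bool) (v w : Pt) :
    lowerTri U W (b :: L) v ∉ removed U W l w := by
  have hlen := hl.length_le
  rintro (h | h)
  · obtain ⟨rfl, -⟩ := eq_of_lowerTri_eq hUW h
    simp at hlen
  · obtain ⟨c, k, rfl, heq⟩ := eq_of_lowerTri_eq_upperTri hUW h
    obtain rfl := (List.cons.inj heq).2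
    simp at hlen

theorem eq_or_level_lt_of_mem_treeQuad {l : List Bool} {w z : Pt} (hz : z ∈ treeQuad U W l w) :
    z = w + treeVec U W l ∨ level U W z < level U W (w + treeVec U W l) := by
  have := level_treeBasis_pos hUW l
  rcases mem_para.1 hz with h | h | h | h
  · exact .inr (by simp only [h, treeVec, level_add]; omega)
  · exact .inr (by simp only [h, treeVec, level_add]; omega)
  · exact .inl h
  · exact .inr (by simp only [h, treeVec, level_add]; omega)

theorem lowerTri_eq_erase (l : List Bool) (w : Pt) :
    lowerTri U W l w = (treeQuad U W l w).erase (w + treeVec U W l) := by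
  have := level_treeBasis_pos hUW l
  ext z
  have hne (h : z ∈ lowerTri U W l w) : z ≠ w + treeVec U W l := by
    rintro rfl
    rcases mem_tri.1 h with h | h | h <;> replace h := congrArg (level U W) h <;>
      simp only [treeVec, level_add] at h <;> omega
  simp only [Finset.mem_erase, treeQuad, mem_para]
  refine ⟨fun h => ⟨hne h, ?_⟩, fun ⟨h, h'⟩ => ?_⟩
  · exact mem_para.1 (tri_subset_para _ _ _ h)
  · rcases h' with h' | h' | h' | h'
    · exact mem_tri.2 (.inl h')
    · exact mem_tri.2 (.inr (.inl h'))
    · exact absurd h' h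
    · exact mem_tri.2 (.inr (.inr h'))

theorem eq_of_treeQuad_eq {l m : List Bool} {w u : Pt} (h : treeQuad U W l w = treeQuad U W m u) :
    l = m ∧ w = u := by
  have hmem (l : List Bool) (w : Pt) : w + treeVec U W l ∈ treeQuad U W l w :=
    mem_para.2 (.inr (.inr (.inl rfl)))
  have htop : w + treeVec U W l = u + treeVec U W m := by
    rcases eq_or_level_lt_of_mem_treeQuad hUW (h.subset (hmem l w)) with h₁ | h₁
    · exact h₁
    rcases eq_or_level_lt_of_mem_treeQuad hUW (h.symm.subset (hmem m u)) with h₂ | h₂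
    · exact h₂.symm
    · omega
  exact eq_of_lowerTri_eq hUW (by rw [lowerTri_eq_erase hUW, lowerTri_eq_erase hUW, h, htop])

end Basis

/-! ### The segment of an edge crosses the unit parallelograms of its flip plan -/

section Crossing

variable (hUW : cross U W = 1)
include hUW

theorem cross_treeVec_treeBasis {l m : List Bool} (h : m <:+ l) :
    cross (treeVec U W l) (treeBasis U W m).1 < 0 ∧
      0 < cross (treeVec U W l) (treeBasis U W m).2 := by
  obtain ⟨k, rfl⟩ := h
  have := cross_treeBasis_nonneg (cross_treeBasis hUW m) k
  rw [treeVec_append, treeVec, cross_swap]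
  simp only [cross_add_left, cross_add_right]
  omega

theorem crossing_of_mem_treeNodes {l m : List Bool} {v w : Pt} (h : (m, w) ∈ treeNodes U W l v) :
    cross (treeVec U W l) (w + (treeBasis U W m).1 - v) < 0 ∧
      0 < cross (treeVec U W l) (w + (treeBasis U W m).2 - v) ∧ 0 ≤ level U W (w - v) ∧
      level U W (w - v) + level U W (treeVec U W m) ≤ level U W (treeVec U W l) := by
  refine treeNodes_induction (P := fun m w =>
    cross (treeVec U W l) (w + (treeBasis U W m).1 - v) < 0 ∧
      0 < cross (treeVec U W l) (w + (treeBasis U W m).2 - v) ∧ 0 ≤ level U W (w - v) ∧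
      level U W (w - v) + level U W (treeVec U W m) ≤ level U W (treeVec U W l)) ?_ ?_ h
  · have := cross_treeVec_treeBasis hUW (l := l) List.suffix_rfl
    simpa [level] using this
  · intro b k u hk hu
    have hcross := cross_treeVec_treeBasis hUW ((List.suffix_cons b k).trans hk)
    have hlevel := level_treeBasis_pos hUW k
    cases b <;>
      simp only [treeVec_cons, treeShift, treeBasis, if_true, Bool.false_eq_true, if_false,
        add_sub_right_comm, level_add, cross_add_right] at hu ⊢ <;> omega

omit hUW in
theorem side_lineMap (v w p E : Pt) (t : ℝ) :
    side w p (AffineMap.lineMap (toPlane v) (toPlane (v + E)) t) =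
      cross p (v - w) + t * cross p E := by
  rw [AffineMap.lineMap_apply_module, side_combo _ _ _ _ (sub_add_cancel 1 t), side_toPlane,
    side_toPlane, add_sub_right_comm, cross_add_right]
  push_cast
  ring

theorem exists_side_lineMap_of_crossing {v w E : Pt} (hU : cross E (w + U - v) < 0)
    (hW : 0 < cross E (w + W - v)) (hw : 0 ≤ level U W (w - v))
    (hE : level U W (w - v) + 2 ≤ level U W E) :
    ∃ t : ℝ, 0 < t ∧ t < 1 ∧ 0 < cross U (v - w) + t * cross U E ∧
      cross W (v - w) + t * cross W E < 0 ∧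
      cross U (v - w) + t * cross U E - (cross W (v - w) + t * cross W E) = 1 := by
  have hN : (0 : ℝ) < level U W E := by exact_mod_cast (by omega : 0 < level U W E)
  obtain ⟨t, ht⟩ : ∃ t : ℝ, level U W E * t = 1 + level U W (w - v) :=
    ⟨_, mul_div_cancel₀ _ hN.ne'⟩
  have hlevel : (level U W E : ℝ) = cross U E - cross W E := by
    simp [level, cross_swap E W, sub_eq_neg_add]
  have hlevel' : (level U W (w - v) : ℝ) = cross W (v - w) - cross U (v - w) := by
    rw [← neg_sub w v, cross_neg_right, cross_neg_right]
    simp [level, cross_swap (w - v) W]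
  have hsideU : level U W E * cross U (v - w) + (1 + level U W (w - v)) * cross U E =
      -cross E (w + U - v) := by
    simp only [level, cross, Prod.fst_sub, Prod.snd_sub, Prod.fst_add, Prod.snd_add] at hUW ⊢
    linear_combination (E.2 * (w.1 - v.1) - E.1 * (w.2 - v.2)) * hUW
  have hsideW : level U W E * cross W (v - w) + (1 + level U W (w - v)) * cross W E =
      -cross E (w + W - v) := by
    simp only [level, cross, Prod.fst_sub, Prod.snd_sub, Prod.fst_add, Prod.snd_add] at hUW ⊢
    linear_combination (E.2 * (w.1 - v.1) - E.1 * (w.2 - v.2)) * hUW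
  rify at hU hW hw hE hsideU hsideW
  refine ⟨t, pos_of_mul_pos_right (by linarith) hN.le, by nlinarith, ?_, ?_, ?_⟩
  · refine pos_of_mul_pos_right ?_ hN.le
    linear_combination hU - hsideU - cross U E * ht
  · refine neg_of_mul_neg_right ?_ hN.le
    linear_combination hW + hsideW + cross W E * ht
  · linear_combination ht + hlevel' - t * hlevel

/-- Take points shortly before and shortly after the segment meets the diagonal that joins `w + U`
and `w + W`. -/
theorem exists_mem_segment_of_crossing {v w E : Pt} (hU : cross E (w + U - v) < 0)
    (hW : 0 < cross E (w + W - v)) (hw : 0 ≤ level U W (w - v))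
    (hE : level U W (w - v) + 2 ≤ level U W E) :
    (∃ x ∈ segment ℝ (toPlane v) (toPlane (v + E)),
      side w W x < 0 ∧ 0 < side w U x ∧ side w U x - side w W x < 1) ∧
    ∃ x ∈ segment ℝ (toPlane v) (toPlane (v + E)),
      -1 < side w W x ∧ side w U x < 1 ∧ 1 < side w U x - side w W x := by
  obtain ⟨t₀, h₀, h₁, hU₀, hW₀, heq⟩ := exists_side_lineMap_of_crossing hUW hU hW hw hE
  have hN : (0 : ℝ) < cross U E - cross W E := by
    rw [cross_swap E W]
    exact_mod_cast (by unfold level at hE hw; omega : 0 < cross U E - -cross E W)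
  have htendsto (p : Pt) : Filter.Tendsto (fun t : ℝ => cross p (v - w) + t * cross p E) (nhds t₀)
      (nhds (cross p (v - w) + t₀ * cross p E)) :=
    Continuous.tendsto (by fun_prop) t₀
  have hnear := (lt_mem_nhds h₀).and <| (gt_mem_nhds h₁).and <|
    ((htendsto U).eventually_const_lt hU₀).and <| ((htendsto W).eventually_lt_const hW₀).and <|
    ((htendsto U).eventually_lt_const (show _ < (1 : ℝ) by linarith)).and <|
    ((htendsto W).eventually_const_lt (show (-1 : ℝ) < _ by linarith))
  have hmem {t : ℝ} (h₀ : 0 < t) (h₁ : t < 1) :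
      AffineMap.lineMap (toPlane v) (toPlane (v + E)) t ∈
        segment ℝ (toPlane v) (toPlane (v + E)) :=
    segment_eq_image_lineMap ℝ (toPlane v) _ ▸ Set.mem_image_of_mem _ ⟨h₀.le, h₁.le⟩
  constructor
  · obtain ⟨t, ⟨h₀, h₁, hU, hW, -⟩, ht : t < t₀⟩ :=
      ((hnear.filter_mono nhdsWithin_le_nhds).and (self_mem_nhdsWithin (s := Set.Iio t₀))).exists
    refine ⟨_, hmem h₀ h₁, ?_⟩
    simp only [side_lineMap]
    exact ⟨hW, hU, by nlinarith⟩
  · obtain ⟨t, ⟨h₀, h₁, -, -, hU, hW⟩, ht : t₀ < t⟩ :=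
      ((hnear.filter_mono nhdsWithin_le_nhds).and (self_mem_nhdsWithin (s := Set.Ioi t₀))).exists
    refine ⟨_, hmem h₀ h₁, ?_⟩
    simp only [side_lineMap]
    exact ⟨hW, hU, by nlinarith⟩

end Crossing

theorem Triangulation.IsEquilateral.removed_nil_subset {T : Triangulation Ω}
    (hT : T.IsEquilateral) (hU : lenSq U = 1) {l : List Bool} {v w : Pt}
    (hΩ : segment ℝ (toPlane v) (toPlane (v + treeVec U (rot U) l)) ⊆ Ω)
    (h : ([], w) ∈ treeNodes U (rot U) l v) : removed U (rot U) [] w ⊆ T.triangles := by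
  have hUW : cross U (rot U) = 1 := by rw [cross_rot, hU]
  have hlevel : level U (rot U) (treeVec U (rot U) []) = 2 := by
    simp [treeVec, treeBasis, level, hUW]
  obtain ⟨h₁, h₂, h₃, h₄⟩ := crossing_of_mem_treeNodes hUW h
  obtain ⟨⟨x, hx, hx'⟩, y, hy, hy'⟩ :=
    exists_mem_segment_of_crossing hUW h₁ h₂ h₃ (hlevel ▸ h₄)
  rintro _ (rfl | rfl)
  · exact hT.lower_mem hU (hΩ hx) hx'.1 hx'.2.1 hx'.2.2
  · exact hT.upper_mem hU (hΩ hy) hy'.1 hy'.2.1 hy'.2.2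

/-! ### Flip paths -/

theorem isFlipPath_append {T T'' : Triangulation Ω} {L M : List Quad} :
    IsFlipPath T (L ++ M) T'' ↔ ∃ T', IsFlipPath T L T' ∧ IsFlipPath T' M T'' := by
  induction L generalizing T with
  | nil => exact ⟨fun h => ⟨T, .nil T, h⟩, by rintro ⟨_, ⟨⟩, h⟩; exact h⟩
  | cons Q L ih =>
    constructor
    · rintro (_ | ⟨h, h'⟩)
      obtain ⟨T', h₁, h₂⟩ := ih.1 h'
      exact ⟨T', .cons h h₁, h₂⟩
    · rintro ⟨T', _ | ⟨h, h₁⟩, h₂⟩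
      exact .cons h (ih.2 ⟨T', h₁, h₂⟩)

theorem isFlipPath_singleton {T T' : Triangulation Ω} {Q : Quad} :
    IsFlipPath T [Q] T' ↔ IsFlip T Q T' :=
  ⟨by rintro (_ | ⟨h, ⟨⟩⟩); exact h, fun h => .cons h (.nil _)⟩

theorem IsFlipPath.isUnimodular {T T' : Triangulation Ω} {L : List Quad}
    (h : IsFlipPath T L T') (hT : T.IsUnimodular) : T'.IsUnimodular := by
  induction h with
  | nil => exact hT
  | cons h _ ih =>
    obtain ⟨w, p, q, -, h⟩ := h.exists_isFlipAt hT
    exact ih (h.isUnimodular hT)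

theorem treeVec_replicate_false (U W : Pt) (n : ℕ) :
    treeVec U W (List.replicate n false) = U + ((n : ℤ) + 1) • W := by
  have h : treeBasis U W (List.replicate n false) = (U + (n : ℤ) • W, W) := by
    induction n with
    | zero => simp [treeBasis]
    | succ n ih =>
      rw [List.replicate_succ, treeBasis, ih]
      push_cast
      rw [add_smul, one_smul, add_assoc]
  rw [treeVec, h, add_smul, one_smul, add_assoc]

theorem treeVec_replicate_true (U W : Pt) (n : ℕ) :
    treeVec U W (List.replicate n true) = W + ((n : ℤ) + 1) • U := by
  have h := treeBasis_map_not W U (List.replicate n true)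
  rw [List.map_replicate, Bool.not_true] at h
  rw [← treeVec_replicate_false, treeVec, treeVec, h]
  exact add_comm _ _

/-- Two such bases differ by a multiple `k` of the common diagonal: the cases are `k = 0`, `0 < k`
and `k < 0`. -/
theorem exists_treeVec_eq_of_add_eq {p q p' q' : Pt} (h : cross p q = 1) (h' : cross p' q' = 1)
    (hadd : p' + q' = p + q) :
    (p' = p ∧ q' = q) ∨ ∃ m, p' = treeVec p q m ∨ q' = treeVec p q m := by
  obtain ⟨k, hk⟩ : ∃ k : ℤ, p' = p + k • (p + q) := by
    refine ⟨cross p p', eq_of_cross_sub_eq_zero h ?_ ?_⟩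
    · simp only [cross_sub_right, cross_smul_right, cross_add_right, cross_self, h]
      ring
    · have hq' : q' = p + q - p' := eq_sub_of_add_eq' hadd
      simp only [hq', cross_sub_right, cross_add_right, cross_self, cross_swap p p'] at h'
      simp only [cross_sub_right, cross_smul_right, cross_add_right, cross_self, cross_swap p q, h,
        cross_swap p' q]
      linarith
  have hk' : q' = q + -k • (p + q) := by
    rw [← eq_sub_iff_add_eq'] at hadd
    rw [hadd, hk, neg_smul]
    abel
  rcases lt_trichotomy k 0 with hneg | rfl | hpos
  · obtain ⟨n, hn⟩ : ∃ n : ℕ, -k = n + 1 := ⟨(-k - 1).toNat, by omega⟩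
    refine .inr ⟨List.replicate n true ++ [false], .inr ?_⟩
    rw [treeVec_append, treeVec_replicate_true, hk', hn]
    rfl
  · exact .inl (by simpa using And.intro hk hk')
  · obtain ⟨n, rfl⟩ : ∃ n : ℕ, k = n + 1 := ⟨(k - 1).toNat, by omega⟩
    refine .inr ⟨List.replicate n false ++ [true], .inl ?_⟩
    rw [treeVec_append, treeVec_replicate_false, hk]
    rfl

theorem IsFlipAt.hasEdge_children {T T' : Triangulation Ω} {b : Bool} {l : List Bool} {w : Pt}
    (h : IsFlipAt T T' w (treeBasis U W (b :: l)).1 (treeBasis U W (b :: l)).2) :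
    T.HasEdge w (w + treeVec U W l) ∧
      T.HasEdge (w + treeShift U W b l) (w + treeShift U W b l + treeVec U W l) := by
  cases b
  · exact ⟨h.hasEdge_left, h.hasEdge_opposite_left⟩
  · exact ⟨h.hasEdge_right, h.hasEdge_opposite_right⟩

section

variable {T T' : Triangulation Ω} {L : List Quad} (hUW : cross U W = 1) (hT : T.IsUnimodular)
  (hlevel : ∀ x y, T.HasEdge x y → level U W (y - x) ≤ 1)
include hUW hT hlevel

/-- A flip path that generates a diagonal of the tree contains all flips of its plan. In the last
step that matters, either the diagonal is that of its Farey parallelogram, whose sides have to be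
there before, or some side of the flipped parallelogram is a diagonal later in the tree. -/
theorem IsFlipPath.mem_of_hasEdge (h : IsFlipPath T L T') {l : List Bool} {v : Pt}
    (hedge : T'.HasEdge v (v + treeVec U W l)) {n : List Bool × Pt}
    (hn : n ∈ treeNodes U W l v) : treeQuad U W n.1 n.2 ∈ L := by
  induction L using List.reverseRecOn generalizing T' l v n with
  | nil =>
    cases h
    have := hlevel _ _ hedge
    have := level_treeBasis_pos hUW l
    rw [add_sub_cancel_left, treeVec, level_add] at *
    omega
  | append_singleton L Q ih =>
    obtain ⟨T₁, hL, hQ⟩ := isFlipPath_append.1 h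
    rw [isFlipPath_singleton] at hQ
    rw [List.mem_append, List.mem_singleton]
    by_cases hold : T₁.HasEdge v (v + treeVec U W l)
    · exact .inl (ih hL hold hn)
    obtain ⟨hv, hv'⟩ := hQ.mem_of_hasEdge hedge hold
    obtain ⟨p, q, rfl, hflip, hpq⟩ :=
      hQ.exists_isFlipAt_of_not_hasEdge (hL.isUnimodular hT) hv hv' hedge.1 hold
    rw [add_right_inj] at hpq
    rcases exists_treeVec_eq_of_add_eq (cross_treeBasis hUW l) hflip.cross_eq hpq.symm with
      ⟨rfl, rfl⟩ | ⟨m, hm⟩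
    · rcases l with - | ⟨b, l⟩
      · obtain rfl := Finset.mem_singleton.1 hn
        exact .inr rfl
      rcases mem_treeNodes_cons.1 hn with rfl | hn | hn
      · exact .inr rfl
      · exact .inl (ih hL hflip.hasEdge_children.1 hn)
      · exact .inl (ih hL hflip.hasEdge_children.2 hn)
    · refine .inl (ih hL (l := m ++ l) (v := v) ?_ (treeNodes_subset_append m l v hn))
      rw [treeVec_append]
      rcases hm with hm | hm <;> rw [← hm]
      · exact hflip.hasEdge_left
      · exact hflip.hasEdge_right

theorem IsFlipPath.children_mem {b : Bool} {l : List Bool} {w : Pt}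
    {M : List Quad} (h : IsFlipPath T (L ++ treeQuad U W (b :: l) w :: M) T')
    (hL : treeQuad U W (b :: l) w ∉ L) :
    treeQuad U W l w ∈ L ∧ treeQuad U W l (w + treeShift U W b l) ∈ L := by
  obtain ⟨T₁, hL', _ | ⟨hflip, -⟩⟩ := isFlipPath_append.1 h
  have hnew : ¬T₁.HasEdge w (w + treeVec U W (b :: l)) := fun hedge =>
    hL (hL'.mem_of_hasEdge hUW hT hlevel hedge (self_mem_treeNodes (b :: l) w))
  have hedges := (hflip.isFlipAt (hL'.isUnimodular hT) (cross_treeBasis hUW _)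
    hnew).hasEdge_children
  exact ⟨hL'.mem_of_hasEdge hUW hT hlevel hedges.1 (self_mem_treeNodes l w),
    hL'.mem_of_hasEdge hUW hT hlevel hedges.2 (self_mem_treeNodes l _)⟩

end

/-! ### Linear orderings of finite posets -/

theorem FlipPoset.IsPoset.exists_isLinearOrdering {π : FlipPoset} (h : π.IsPoset) :
    ∃ L, π.IsLinearOrdering L := by
  classical
  have : IsTrans Quad π.le := ⟨h.trans⟩
  have : IsPartialOrder Quad (Relation.ReflGen π.le) :=
    { antisymm := by
        rintro P Q (- | hPQ) (- | hQP)
        · rfl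
        · rfl
        · rfl
        · exact h.antisymm P Q hPQ hQP }
  obtain ⟨s, hs, hle⟩ := extend_partialOrder (Relation.ReflGen π.le)
  refine ⟨π.flips.sort s, ⟨Finset.sort_nodup _ _, fun Q => Finset.mem_sort _⟩, ?_⟩
  refine ((Finset.pairwise_sort π.flips s).and (Finset.sort_nodup π.flips s)).imp ?_
  rintro P Q ⟨hPQ, hne⟩ hQP
  exact hne (antisymm_of s hPQ (hle _ _ (.single hQP)))

theorem FlipPoset.IsLinearOrdering.mem_of_le {π : FlipPoset} (hπ : π.IsPoset) {P Q : Quad}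
    {X Y : List Quad} (h : π.IsLinearOrdering (X ++ Q :: Y)) (hle : π.le P Q) (hne : P ≠ Q) :
    P ∈ X := by
  rcases List.mem_append.1 ((h.1.2 P).2 (hπ.mem_of_le P Q hle).1) with hP | hP
  · exact hP
  · have hY := (List.mem_cons.1 hP).resolve_left hne
    exact absurd hle (List.rel_of_pairwise_cons (List.pairwise_append.1 h.2).2.1 hY)

/-- The order with the additional relation `Q ≤ P`, and with what transitivity then demands. -/
def FlipPoset.addLE (π : FlipPoset) (Q P : Quad) : FlipPoset :=
  ⟨π.flips, fun A B => π.le A B ∨ (π.le A Q ∧ π.le P B)⟩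

theorem FlipPoset.IsPoset.addLE {π : FlipPoset} (h : π.IsPoset) {P Q : Quad}
    (hPQ : ¬π.le P Q) : (π.addLE Q P).IsPoset where
  mem_of_le := by
    rintro A B (hAB | ⟨hAQ, hPB⟩)
    · exact h.mem_of_le _ _ hAB
    · exact ⟨(h.mem_of_le _ _ hAQ).1, (h.mem_of_le _ _ hPB).2⟩
  refl A hA := .inl (h.refl A hA)
  trans := by
    rintro A B C (hAB | ⟨hAQ, hPB⟩) (hBC | ⟨hBQ, hPC⟩)
    · exact .inl (h.trans _ _ _ hAB hBC)
    · exact .inr ⟨h.trans _ _ _ hAB hBQ, hPC⟩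
    · exact .inr ⟨hAQ, h.trans _ _ _ hPB hBC⟩
    · exact absurd (h.trans _ _ _ hPB hBQ) hPQ
  antisymm := by
    rintro A B (hAB | ⟨hAQ, hPB⟩) (hBA | ⟨hBQ, hPA⟩)
    · exact h.antisymm _ _ hAB hBA
    · exact absurd (h.trans _ _ _ (h.trans _ _ _ hPA hAB) hBQ) hPQ
    · exact absurd (h.trans _ _ _ (h.trans _ _ _ hPB hBA) hAQ) hPQ
    · exact absurd (h.trans _ _ _ hPB hBQ) hPQ

theorem FlipPoset.IsPoset.le_of_isLinearOrdering_imp {π σ : FlipPoset} (hπ : π.IsPoset)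
    (hσ : σ.IsPoset) (hflips : π.flips = σ.flips)
    (himp : ∀ L, π.IsLinearOrdering L → σ.IsLinearOrdering L) {P Q : Quad} (hle : σ.le P Q) :
    π.le P Q := by
  by_contra hPQ
  obtain ⟨hP, hQ⟩ := hσ.mem_of_le P Q hle
  rw [← hflips] at hP hQ
  have hne : P ≠ Q := by
    rintro rfl
    exact hPQ (hπ.refl P hP)
  have hρ := hπ.addLE hPQ
  obtain ⟨L, hL⟩ := hρ.exists_isLinearOrdering
  have hσL : σ.IsLinearOrdering L := himp L ⟨hL.1, hL.2.imp fun hn h => hn (.inl h)⟩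
  obtain ⟨X, Y, rfl⟩ := List.append_of_mem ((hL.1.2 Q).2 hQ)
  obtain ⟨X₁, X₂, rfl⟩ := List.append_of_mem (hσL.mem_of_le hσ hle hne)
  have hQ₁ : Q ∈ X₁ := by
    rw [List.append_assoc, List.cons_append] at hL
    exact hL.mem_of_le hρ (.inr ⟨hπ.refl Q hQ, hπ.refl P hP⟩) hne.symm
  exact List.disjoint_of_nodup_append hL.1.1 (List.mem_append_left _ hQ₁) List.mem_cons_self

theorem FlipPoset.eq_of_isLinearOrdering_iff {π σ : FlipPoset} (hπ : π.IsPoset)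
    (hσ : σ.IsPoset) (hflips : π.flips = σ.flips)
    (h : ∀ L, π.IsLinearOrdering L ↔ σ.IsLinearOrdering L) : π = σ :=
  FlipPoset.ext hflips <| funext₂ fun _ _ => propext
    ⟨hσ.le_of_isLinearOrdering_imp hπ hflips.symm fun L => (h L).2,
      hπ.le_of_isLinearOrdering_imp hσ hflips fun L => (h L).1⟩

/-! ### Minimum flip plans -/

theorem FlipPoset.ListsFlips.length_eq {π : FlipPoset} {L : List Quad} (h : π.ListsFlips L) :
    L.length = π.flips.card := by
  have hL : L.toFinset = π.flips := Finset.ext fun Q => List.mem_toFinset.trans (h.2 Q)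
  rw [← hL, List.toFinset_card_of_nodup h.1]

section

variable {T : Triangulation Ω} {a b : Pt} {π : FlipPoset}

theorem FlipPoset.IsFlipPlan.isMinimumFlipPlan (h : π.IsFlipPlan T a b)
    (hmem : ∀ L, Generates T L a b → ∀ Q ∈ π.flips, Q ∈ L) : π.IsMinimumFlipPlan T a b := by
  refine ⟨h, fun L hL L' hL' => ?_⟩
  calc L.length = π.flips.card := hL.1.length_eq
    _ ≤ L'.toFinset.card :=
      Finset.card_le_card fun Q hQ => List.mem_toFinset.2 (hmem L' hL' Q hQ)
    _ ≤ L'.length := L'.toFinset_card_le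

theorem FlipPoset.IsMinimumFlipPlan.eq_of_isFlipPlan {σ : FlipPoset}
    (hσ : σ.IsMinimumFlipPlan T a b) (h : π.IsFlipPlan T a b)
    (hmem : ∀ L, Generates T L a b → ∀ Q ∈ π.flips, Q ∈ L) : σ = π := by
  obtain ⟨hσ, hmin⟩ := hσ
  obtain ⟨L, hL⟩ := h.1.exists_isLinearOrdering
  obtain ⟨M, hM⟩ := hσ.1.exists_isLinearOrdering
  have hcard := hmin M hM L ((h.2 L).1 hL).1
  rw [hM.1.length_eq, hL.1.length_eq] at hcard
  have hflips : π.flips = σ.flips :=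
    Finset.eq_of_subset_of_card_le
      (fun Q hQ => (hM.1.2 Q).1 (hmem M ((hσ.2 M).1 hM).1 Q hQ)) hcard
  refine FlipPoset.eq_of_isLinearOrdering_iff hσ.1 h.1 hflips.symm fun L => ?_
  rw [h.2, hσ.2]
  simp only [FlipPoset.ListsFlips, hflips]

end

/-! ### The poset of a directed acyclic graph -/

/-- The partially ordered set of a directed acyclic graph of flips: descendants are smaller. -/
def FlipDag.toPoset (D : FlipDag) : FlipPoset :=
  ⟨D.flips, fun P Q => P ∈ D.flips ∧ Q ∈ D.flips ∧
    Relation.ReflTransGen (fun A B => (A, B) ∈ D.arcs) P Q⟩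

/-- Acyclicity is expressed by a rank that increases along the arcs. -/
theorem FlipDag.isPoset_toPoset {D : FlipDag} {rank : Quad → ℕ}
    (hrank : ∀ P Q, (P, Q) ∈ D.arcs → rank P < rank Q) : D.toPoset.IsPoset where
  mem_of_le _ _ h := ⟨h.1, h.2.1⟩
  refl _ h := ⟨h, h, .refl⟩
  trans _ _ _ h h' := ⟨h.1, h'.2.1, h.2.2.trans h'.2.2⟩
  antisymm P Q h h' := by
    have rank_lt {A B : Quad} (hAB : Relation.TransGen (fun A B => (A, B) ∈ D.arcs) A B) :
        rank A < rank B := by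
      induction hAB with
      | single h => exact hrank _ _ h
      | tail _ h ih => exact ih.trans (hrank _ _ h)
    rcases Relation.reflTransGen_iff_eq_or_transGen.1 h.2.2 with rfl | h
    · rfl
    rcases Relation.reflTransGen_iff_eq_or_transGen.1 h'.2.2 with rfl | h'
    · rfl
    exact absurd (rank_lt h) (rank_lt h').asymm

theorem FlipDag.isLinearOrdering_toPoset {D : FlipDag} {L : List Quad}
    (hL : D.toPoset.ListsFlips L)
    (harcs : ∀ X Y P Q, L = X ++ Q :: Y → (P, Q) ∈ D.arcs → P ∈ X) :
    D.toPoset.IsLinearOrdering L := by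
  have eq_or_mem {P Q : Quad} (h : Relation.ReflTransGen (fun A B => (A, B) ∈ D.arcs) P Q) :
      ∀ X Y, L = X ++ Q :: Y → P = Q ∨ P ∈ X := by
    induction h with
    | refl => exact fun _ _ _ => .inl rfl
    | @tail R Q _ h ih =>
      intro X Y hXY
      obtain ⟨X₁, X₂, rfl⟩ := List.append_of_mem (harcs X Y R Q hXY h)
      rcases ih X₁ (X₂ ++ Q :: Y) (by rw [hXY, List.append_assoc, List.cons_append]) with rfl | hP
      · exact .inr (List.mem_append_right _ List.mem_cons_self)
      · exact .inr (List.mem_append_left _ hP)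
  refine ⟨hL, List.pairwise_iff_getElem.2 fun i j hi hj hij hle => ?_⟩
  rcases eq_or_mem hle.2.2 (L.take i) (L.drop (i + 1)) (by simp) with h | h
  · exact hij.ne' (hL.1.getElem_inj_iff.1 h)
  · obtain ⟨k, hk, hkj⟩ := List.mem_take_iff_getElem.1 h
    have := hL.1.getElem_inj_iff.1 hkj
    omega

/-! ### The flip plan of an edge as a flip plan -/

theorem exists_rank_lt_of_mem_treeDag_arcs (hUW : cross U W = 1) :
    ∃ rank : Quad → ℕ, ∀ l v P Q, (P, Q) ∈ (treeDag U W l v).arcs → rank P < rank Q := by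
  have hinj : Function.Injective fun n : List Bool × Pt => treeQuad U W n.1 n.2 := fun n m h =>
    Prod.ext_iff.2 (eq_of_treeQuad_eq hUW h)
  obtain ⟨rank, hrank⟩ : ∃ rank : Quad → ℕ, ∀ m w, rank (treeQuad U W m w) = m.length :=
    ⟨Function.extend (fun n : List Bool × Pt => treeQuad U W n.1 n.2) (fun n => n.1.length) 0,
      fun m w => hinj.extend_apply _ _ (m, w)⟩
  refine ⟨rank, fun l v P Q h => ?_⟩
  obtain ⟨b, m, w, -, rfl, rfl | rfl⟩ := mem_treeDag_arcs.1 h <;>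
    simp only [hrank, List.length_cons, Nat.lt_succ_self]

theorem isPoset_treeDag (hUW : cross U W = 1) (l : List Bool) (v : Pt) :
    (treeDag U W l v).toPoset.IsPoset := by
  obtain ⟨rank, hrank⟩ := exists_rank_lt_of_mem_treeDag_arcs hUW
  exact FlipDag.isPoset_toPoset (hrank l v)

section

variable {T : Triangulation Ω} {l : List Bool} {v : Pt}

theorem mem_of_isLinearOrdering_treeDag (hUW : cross U W = 1) {X Y : List Quad} {b : Bool}
    {m : List Bool} {w z : Pt} (hL : (treeDag U W l v).toPoset.IsLinearOrdering
      (X ++ treeQuad U W (b :: m) w :: Y)) (hn : (b :: m, w) ∈ treeNodes U W l v)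
    (hz : z = w ∨ z = w + treeShift U W b m) : treeQuad U W m z ∈ X := by
  refine hL.mem_of_le (isPoset_treeDag hUW l v) ⟨?_, ?_, .single ?_⟩ fun h => ?_
  · obtain ⟨hw, hw'⟩ := children_mem_treeNodes hn
    rcases hz with rfl | rfl
    · exact mem_treeDag_flips.2 ⟨_, hw, rfl⟩
    · exact mem_treeDag_flips.2 ⟨_, hw', rfl⟩
  · exact mem_treeDag_flips.2 ⟨_, hn, rfl⟩
  · exact mem_treeDag_arcs.2 ⟨b, m, w, hn, rfl, by rcases hz with rfl | rfl <;> simp⟩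
  · exact List.cons_ne_self b m (eq_of_treeQuad_eq hUW h).1.symm

/-- Triangles are never added again after their removal, so performing the flips of `A` preserves
the triangles that occur and that no flip of `A` removes. -/
theorem exists_isFlipPath_of_isLinearOrdering (hUW : cross U W = 1)
    (hroot : ∀ w, ([], w) ∈ treeNodes U W l v → removed U W [] w ⊆ T.triangles)
    {A B : List Quad} (hL : (treeDag U W l v).toPoset.IsLinearOrdering (A ++ B)) :
    ∃ T' : Triangulation Ω, IsFlipPath T A T' ∧ ∀ t,
      (t ∈ T.triangles ∨
        ∃ n ∈ treeNodes U W l v, treeQuad U W n.1 n.2 ∈ A ∧ t ∈ added U W n.1 n.2) →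
      (∀ n ∈ treeNodes U W l v, treeQuad U W n.1 n.2 ∈ A → t ∉ removed U W n.1 n.2) →
      t ∈ T'.triangles := by
  induction A using List.reverseRecOn generalizing B with
  | nil => exact ⟨T, .nil T, by simp⟩
  | append_singleton A Q ih =>
    rw [List.append_assoc, List.singleton_append] at hL
    obtain ⟨T₁, hT₁, htriangles⟩ := ih hL
    obtain ⟨⟨m, w⟩, hn, rfl⟩ := mem_treeDag_flips.1 ((hL.1.2 Q).1 (by simp))
    have hQA : treeQuad U W m w ∉ A := fun h =>
      List.disjoint_of_nodup_append hL.1.1 h List.mem_cons_self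
    have hremoved : removed U W m w ⊆ T₁.triangles := by
      intro t ht
      refine htriangles t ?_ fun ⟨m', w'⟩ hn' hA ht' => hQA ?_
      · cases m with
        | nil => exact .inl (hroot w hn ht)
        | cons b m =>
          obtain ⟨hw, hw'⟩ := children_mem_treeNodes hn
          rcases mem_added_of_mem_removed_cons ht with h | h
          · exact .inr ⟨_, hw, mem_of_isLinearOrdering_treeDag hUW hL hn (.inl rfl), h⟩
          · exact .inr ⟨_, hw', mem_of_isLinearOrdering_treeDag hUW hL hn (.inr rfl), h⟩
      · obtain ⟨rfl, rfl⟩ := eq_of_mem_removed hUW (suffix_of_mem_treeNodes hn')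
          (suffix_of_mem_treeNodes hn) ht' ht
        exact hA
    obtain ⟨T₂, hT₂⟩ := T₁.exists_isFlipAt (cross_treeBasis hUW m) (hremoved (.inl rfl))
      (hremoved (.inr rfl))
    refine ⟨T₂, isFlipPath_append.2 ⟨T₁, hT₁, isFlipPath_singleton.2 hT₂.isFlip⟩,
      fun t ht hnot => ?_⟩
    rw [hT₂.triangles_eq]
    by_cases hadded : t ∈ added U W m w
    · exact .inr hadded
    refine .inl ⟨htriangles t (ht.imp_right ?_) fun n hn hA => hnot n hn
      (List.mem_append_left _ hA), hnot (m, w) hn (by simp)⟩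
    rintro ⟨n', hn', hA, ht'⟩
    refine ⟨n', hn', (List.mem_append.1 hA).resolve_right fun h => hadded ?_, ht'⟩
    obtain ⟨rfl, rfl⟩ := eq_of_treeQuad_eq hUW (List.mem_singleton.1 h)
    exact ht'

theorem generates_of_isLinearOrdering (hUW : cross U W = 1)
    (hroot : ∀ w, ([], w) ∈ treeNodes U W l v → removed U W [] w ⊆ T.triangles)
    {L : List Quad} (hL : (treeDag U W l v).toPoset.IsLinearOrdering L) :
    Generates T L v (v + treeVec U W l) := by
  obtain ⟨T', hT', htriangles⟩ :=
    exists_isFlipPath_of_isLinearOrdering hUW hroot (A := L) (B := []) (by rwa [List.append_nil])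
  have hne : treeVec U W l ≠ 0 := by
    intro h
    have hl := cross_treeBasis hUW l
    rw [treeVec, add_eq_zero_iff_eq_neg] at h
    simp [h] at hl
  refine ⟨T', hT', left_ne_add.2 hne, lowerTri U W (true :: l) v, htriangles _
    (.inr ⟨(l, v), self_mem_treeNodes l v, ?_, .inl rfl⟩) fun n hn _ =>
      lowerTri_cons_notMem_removed hUW (suffix_of_mem_treeNodes hn) true v n.2, ?_, ?_⟩
  · exact (hL.1.2 _).2 (mem_treeDag_flips.2 ⟨_, self_mem_treeNodes l v, rfl⟩)
  · simp [lowerTri, tri]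
  · simp [lowerTri, tri, treeBasis, treeVec]

theorem isFlipPlan_treeDag (hUW : cross U W = 1) (hT : T.IsUnimodular)
    (hlevel : ∀ x y, T.HasEdge x y → level U W (y - x) ≤ 1)
    (hroot : ∀ w, ([], w) ∈ treeNodes U W l v → removed U W [] w ⊆ T.triangles) :
    (treeDag U W l v).toPoset.IsFlipPlan T v (v + treeVec U W l) := by
  refine ⟨isPoset_treeDag hUW l v, fun L =>
    ⟨fun hL => ⟨generates_of_isLinearOrdering hUW hroot hL, hL.1⟩, ?_⟩⟩
  rintro ⟨⟨T', hT', -⟩, hL⟩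
  refine FlipDag.isLinearOrdering_toPoset hL ?_
  rintro X Y P Q rfl harc
  obtain ⟨b, m, w, -, rfl, hP⟩ := mem_treeDag_arcs.1 harc
  have hchildren := hT'.children_mem hUW hT hlevel fun h =>
    List.disjoint_of_nodup_append hL.1 h List.mem_cons_self
  rcases hP with rfl | rfl
  · exact hchildren.1
  · exact hchildren.2

end

theorem isFlipPlan_toPoset_empty {T : Triangulation Ω} {a b : Pt} (h : T.HasEdge a b) :
    (FlipDag.mk ∅ ∅).toPoset.IsFlipPlan T a b := by
  refine ⟨FlipDag.isPoset_toPoset (rank := 0) (by simp), fun L => ⟨fun hL => ⟨?_, hL.1⟩,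
    fun hL => FlipDag.isLinearOrdering_toPoset hL.2 (by simp)⟩⟩
  obtain rfl : L = [] :=
    List.eq_nil_iff_forall_not_mem.2 fun Q hQ => Finset.notMem_empty Q ((hL.1.2 Q).1 hQ)
  exact ⟨T, .nil T, h⟩

theorem Edge.IsUnit.flipPlan_eq {e : Edge} (he : e.IsUnit) (v : Pt) :
    flipPlan e v = (FlipDag.mk ∅ ∅).toPoset := by
  rw [flipPlan, fareyPlan, if_pos he]
  rfl

theorem exists_flipPlan_eq_treeDag {e : Edge} (he : ¬e.IsUnit) :
    ∃ l, e.vec = treeVec (coordPair e.pair).1 (coordPair e.pair).2 l ∧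
      ∀ v, flipPlan e v = (treeDag (coordPair e.pair).1 (coordPair e.pair).2 l v).toPoset := by
  obtain ⟨l, hvec, hdag⟩ := exists_flipDag_eq_treeDag he
  exact ⟨l, hvec, fun v => congrArg FlipDag.toPoset (hdag v)⟩

theorem exists_eq_fareyParallelogram_of_mem_flipPlan {e : Edge} {v : Pt} {Q : Quad}
    (hQ : Q ∈ (flipPlan e v).flips) : ∃ g w, ¬g.IsUnit ∧ Q = fareyParallelogram g w := by
  by_cases he : e.IsUnit
  · rw [he.flipPlan_eq] at hQ
    exact absurd hQ (Finset.notMem_empty Q)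
  · obtain ⟨l, -, hplan⟩ := exists_flipPlan_eq_treeDag he
    rw [hplan] at hQ
    obtain ⟨n, -, rfl⟩ := mem_treeDag_flips.1 hQ
    obtain ⟨g, hg, hquad⟩ := exists_treeQuad_eq_fareyParallelogram e.pair n.1 n.2
    exact ⟨g, n.2, hg, hquad⟩

namespace Triangulation.IsEquilateral

variable {T : Triangulation Ω} (hT : T.IsEquilateral) {e : Edge} {v : Pt}
include hT

theorem mem_of_generates_of_mem_flipPlan {L : List Quad} (hL : Generates T L v (v + e.vec))
    {Q : Quad} (hQ : Q ∈ (flipPlan e v).flips) : Q ∈ L := by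
  by_cases he : e.IsUnit
  · rw [he.flipPlan_eq] at hQ
    exact absurd hQ (Finset.notMem_empty Q)
  · obtain ⟨l, hvec, hplan⟩ := exists_flipPlan_eq_treeDag he
    rw [hplan] at hQ
    rw [hvec] at hL
    obtain ⟨n, hn, rfl⟩ := mem_treeDag_flips.1 hQ
    obtain ⟨T', hL, hedge⟩ := hL
    refine hL.mem_of_hasEdge (cross_coordPair e.pair) hT.isUnimodular (fun x y h => ?_) hedge hn
    rw [coordPair_snd]
    exact hT.level_le_one (lenSq_coordPair_fst e.pair) h

theorem isFlipPlan_flipPlan (hΩ : segment ℝ (toPlane v) (toPlane (v + e.vec)) ⊆ Ω) :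
    (flipPlan e v).IsFlipPlan T v (v + e.vec) := by
  by_cases he : e.IsUnit
  · rw [he.flipPlan_eq]
    exact isFlipPlan_toPoset_empty (hT.hasEdge_of_isUnit he hΩ)
  · obtain ⟨l, hvec, hplan⟩ := exists_flipPlan_eq_treeDag he
    have hUW := cross_coordPair e.pair
    have hU := lenSq_coordPair_fst e.pair
    rw [hplan, hvec]
    rw [hvec] at hΩ
    rw [coordPair_snd] at hUW hΩ ⊢
    exact isFlipPlan_treeDag hUW hT.isUnimodular (fun x y => hT.level_le_one hU)
      fun w => hT.removed_nil_subset hU hΩ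

end Triangulation.IsEquilateral

end LatticeFlip

open LatticeFlip
theorem mainTheorem3 (Ω : Set Plane) (T : Triangulation Ω) (hT : T.IsEquilateral)
    (e : Edge) (v : Pt) (he : segment ℝ (toPlane v) (toPlane (v + e.vec)) ⊆ Ω) :
    (∃! π : FlipPoset, π.IsMinimumFlipPlan T v (v + e.vec)) ∧
    (flipPlan e v).IsMinimumFlipPlan T v (v + e.vec) ∧
    (∀ π : FlipPoset, π.IsMinimumFlipPlan T v (v + e.vec) → π.flips = (flipPlan e v).flips) ∧
    (∀ Q ∈ (flipPlan e v).flips, ∃ (g : Edge) (w : Pt), ¬ g.IsUnit ∧ Q = fareyParallelogram g w) := by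
  have hplan : (flipPlan e v).IsFlipPlan T v (v + e.vec) := hT.isFlipPlan_flipPlan he
  have hnecessary : ∀ L, Generates T L v (v + e.vec) → ∀ Q ∈ (flipPlan e v).flips, Q ∈ L :=
    fun L hL Q hQ => hT.mem_of_generates_of_mem_flipPlan hL hQ
  have hmin : (flipPlan e v).IsMinimumFlipPlan T v (v + e.vec) :=
    hplan.isMinimumFlipPlan hnecessary
  have hunique : ∀ π : FlipPoset, π.IsMinimumFlipPlan T v (v + e.vec) → π = flipPlan e v :=
    fun π hπ => hπ.eq_of_isFlipPlan hplan hnecessary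
  exact ⟨⟨_, hmin, hunique⟩, hmin, fun π hπ => congrArg FlipPoset.flips (hunique π hπ),
    fun Q hQ => exists_eq_fareyParallelogram_of_mem_flipPlan hQ⟩
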